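/- Let $n\ge 0$ and $k\ge 1$ ($k=\infty$ is allowed), and let $A\in\mathcal C^k([0,1],\mathbb C^{n\times n})$ have distinct, nonzero singular values $\sigma_1(t)>\dots>\sigma_n(t)>0$ for all $t\in[0,1]$. By a $\mathcal C^m$ singular value decomposition (SVD) of $A$ we mean $A(t)=U(t)\Sigma(t)V(t)^*$, $t\in[0,1]$, with $U,\Sigma,V$ of class $\mathcal C^m$ on $[0,1]$, $U(t),V(t)$ unitary and $\Sigma(t)=\operatorname{diag}(\sigma_1(t),\dots,\sigma_n(t))$, the diagonal entries being real, nonnegative and in decreasing order. (a) Given any SVD $A(0)=U_0\Sigma_0V_0^*$ at $t=0$, there is exactly one $\mathcal C^k$ SVD $A=U\Sigma V^*$ on $[0,1]$ with $U(0)=U_0$, $\Sigma(0)=\Sigma_0$, $V(0)=V_0$ whose pair $(U,V)$ minimizes $$\int_0^1\sqrt{\|\dot U(t)\|_{\mathrm F}^2+\|\dot V(t)\|_{\mathrm F}^2}\,dt$$ among all $\mathcal C^1$ SVDs of $A$ on $[0,1]$ (with arbitrary initial factors). A $\mathcal C^k$ SVD with this minimizing property is called a joint minimum variation decomposition (joint-MVD).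 (b) A $\mathcal C^k$ SVD $A=U\Sigma V^*$ on $[0,1]$ is a joint-MVD if and only if there are matrix functions $H,K$ on $[0,1]$ which satisfy the SVD differential equations $$\dot\Sigma=U^*\dot AV-H\Sigma+\Sigma K,\qquad \dot U=UH,\qquad \dot V=VK,$$ where $H(t),K(t)$ are skew-Hermitian and, with $F=U^*\dot AV$, $$H_{j\ell}=\frac{\sigma_\ell F_{j\ell}+\sigma_j\overline{F_{\ell j}}}{\sigma_\ell^2-\sigma_j^2},\qquad K_{j\ell}=\frac{\sigma_\ell\overline{F_{\ell j}}+\sigma_jF_{j\ell}}{\sigma_\ell^2-\sigma_j^2}\quad(j\ne\ell),\qquad H_{jj}-K_{jj}=\frac{i\,\operatorname{Im}F_{jj}}{\sigma_j},$$ and which in addition satisfy $H_{jj}(t)+K_{jj}(t)=0$ for all $t\in[0,1]$ and $j=1,\dots,n$. -/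

import Mathlib

open Set Matrix

/-! Square complex matrices carry the Frobenius norm throughout. -/
attribute [local instance] Matrix.frobeniusNormedAddCommGroup Matrix.frobeniusNormedSpace

noncomputable section

/-- The singular values `σ₁ ≥ ⋯ ≥ σₙ` of a square complex matrix, in decreasing order and with
multiplicity: those of the linear map on `ℂⁿ` (Euclidean norm) that the matrix represents. -/
def singularValue {n : ℕ} (A : Matrix (Fin n) (Fin n) ℂ) (j : Fin n) : ℝ :=
  (Matrix.toEuclideanLin A).singularValues j

/-- The matrix `Σ = diag(σ₁, …, σₙ)`, as a complex matrix. -/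
def sigmaMatrix {n : ℕ} (σ : Fin n → ℝ) : Matrix (Fin n) (Fin n) ℂ :=
  Matrix.diagonal fun j => (σ j : ℂ)

/-- `A = U Σ V*` is a singular value decomposition: `U`, `V` are unitary and
`Σ = diag(σ₁, …, σₙ)` with `σ₁ ≥ ⋯ ≥ σₙ ≥ 0`. -/
structure IsSVD {n : ℕ} (A U : Matrix (Fin n) (Fin n) ℂ) (σ : Fin n → ℝ)
    (V : Matrix (Fin n) (Fin n) ℂ) : Prop where
  unitary_left : U ∈ Matrix.unitaryGroup (Fin n) ℂ
  unitary_right : V ∈ Matrix.unitaryGroup (Fin n) ℂ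
  nonneg : ∀ j, 0 ≤ σ j
  antitone : Antitone σ
  eq : A = U * sigmaMatrix σ * Vᴴ

/-- `A(t) = U(t) Σ(t) V(t)*`, `t ∈ [0,1]`, is a `C^k` singular value decomposition. -/
structure IsSVDPath {n : ℕ} (k : ℕ∞) (A U : ℝ → Matrix (Fin n) (Fin n) ℂ)
    (σ : ℝ → Fin n → ℝ) (V : ℝ → Matrix (Fin n) (Fin n) ℂ) : Prop where
  contDiffOn_left : ContDiffOn ℝ k U (Icc 0 1)
  contDiffOn_sigma : ContDiffOn ℝ k σ (Icc 0 1)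
  contDiffOn_right : ContDiffOn ℝ k V (Icc 0 1)
  isSVD : ∀ t ∈ Icc (0 : ℝ) 1, IsSVD (A t) (U t) (σ t) (V t)

/-- The joint variation `∫₀¹ √(‖U'(t)‖_F² + ‖V'(t)‖_F²) dt`; derivatives at the endpoints of
`[0,1]` are one-sided. -/
def jointVariation {n : ℕ} (U V : ℝ → Matrix (Fin n) (Fin n) ℂ) : ℝ :=
  ∫ t in (0 : ℝ)..1,
    √(‖derivWithin U (Icc 0 1) t‖ ^ 2 + ‖derivWithin V (Icc 0 1) t‖ ^ 2)

/-- A `C^k` joint minimum variation decomposition of `A`: a `C^k` singular value decomposition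
whose unitary factors minimize the joint variation among all continuously differentiable singular
value decompositions of `A` over `[0,1]` (with arbitrary initial factors). -/
def IsJointMVD {n : ℕ} (k : ℕ∞) (A U : ℝ → Matrix (Fin n) (Fin n) ℂ)
    (σ : ℝ → Fin n → ℝ) (V : ℝ → Matrix (Fin n) (Fin n) ℂ) : Prop :=
  IsSVDPath k A U σ V ∧
    ∀ (P : ℝ → Matrix (Fin n) (Fin n) ℂ) (τ : ℝ → Fin n → ℝ)
      (Q : ℝ → Matrix (Fin n) (Fin n) ℂ),
      IsSVDPath 1 A P τ Q → jointVariation U V ≤ jointVariation P Q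

/-- The matrix `U(t)* A'(t) V(t)`. -/
def svdDrive {n : ℕ} (A U V : ℝ → Matrix (Fin n) (Fin n) ℂ) (t : ℝ) :
    Matrix (Fin n) (Fin n) ℂ :=
  (U t)ᴴ * derivWithin A (Icc 0 1) t * V t

/-- The differential-algebraic equations of a smooth singular value decomposition on `[0,1]`:
`Σ' = U*A'V - HΣ + ΣK`, `U' = UH`, `V' = VK`, with `H`, `K` skew-Hermitian, their off-diagonal
entries given in terms of `U*A'V` and the singular values, and the differences of their diagonal
entries prescribed. -/
structure SVDEquations {n : ℕ} (A U : ℝ → Matrix (Fin n) (Fin n) ℂ)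
    (σ : ℝ → Fin n → ℝ) (V H K : ℝ → Matrix (Fin n) (Fin n) ℂ) : Prop where
  deriv_sigma : ∀ t ∈ Icc (0 : ℝ) 1,
    HasDerivWithinAt (fun s => sigmaMatrix (σ s))
      (svdDrive A U V t - H t * sigmaMatrix (σ t) + sigmaMatrix (σ t) * K t) (Icc 0 1) t
  deriv_left : ∀ t ∈ Icc (0 : ℝ) 1, HasDerivWithinAt U (U t * H t) (Icc 0 1) t
  deriv_right : ∀ t ∈ Icc (0 : ℝ) 1, HasDerivWithinAt V (V t * K t) (Icc 0 1) t
  skew_left : ∀ t ∈ Icc (0 : ℝ) 1, (H t)ᴴ = -H t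
  skew_right : ∀ t ∈ Icc (0 : ℝ) 1, (K t)ᴴ = -K t
  offdiag_left : ∀ t ∈ Icc (0 : ℝ) 1, ∀ j l, j ≠ l →
    H t j l = (σ t l * svdDrive A U V t j l + σ t j * star (svdDrive A U V t l j)) /
      ((σ t l : ℂ) ^ 2 - (σ t j : ℂ) ^ 2)
  offdiag_right : ∀ t ∈ Icc (0 : ℝ) 1, ∀ j l, j ≠ l →
    K t j l = (σ t l * star (svdDrive A U V t l j) + σ t j * svdDrive A U V t j l) /
      ((σ t l : ℂ) ^ 2 - (σ t j : ℂ) ^ 2)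
  diag_sub : ∀ t ∈ Icc (0 : ℝ) 1, ∀ j,
    H t j j - K t j j = Complex.I * ((svdDrive A U V t j j).im : ℂ) / (σ t j : ℂ)

end

/-!
Since the eigenvalues `σⱼ²` of `A*A` are simple, they and their spectral projections are as smooth
as `A`. Kato's parallel transport along the projections carries `V(0)` to eigenvectors `V(t)` of
`A(t)*A(t)`, and `U = A V Σ⁻¹` completes a smooth singular value decomposition with prescribed
initial factors. Any other one differs from it by a path of phases,
`(U, V) ↦ (U diag(e), V diag(e))`.

With `H = U*U'` and `K = V*V'`, the squared speed of the rephased pair is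
`‖H + D‖² + ‖K + D‖²`, where `D = diag(ē e')`. If `Hⱼⱼ + Kⱼⱼ = 0` for all `j`, then `(D, D)` is
orthogonal to `(H, K)` and the squared speed becomes `‖H‖² + ‖K‖² + 2‖D‖²`. So a decomposition with
this property has minimal joint variation, and the other minimizers arise from it by constant
phases. It is reached from any decomposition by solving `e' = -½ (Hⱼⱼ + Kⱼⱼ) e`, `e(0) = 1`. The
formulas for `H` and `K` come from solving the entries of `U*A'V = HΣ + Σ' - ΣK` and of its
conjugate transpose.
-/

noncomputable section

section LinearODE

open scoped NNReal

variable {E : Type*} [NormedAddCommGroup E] [NormedSpace ℝ E]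
  {v : ℝ → E → E} {α β γ : ℝ → E} {s s' : Set ℝ} {a b c : ℝ}

theorem isIntegralCurveOn_congr (hα : IsIntegralCurveOn α v s) (h : EqOn γ α s) :
    IsIntegralCurveOn γ v s := fun t ht => by
  rw [h ht]
  exact (hα t ht).congr h (h ht)

theorem isIntegralCurveOn_union (hs : IsClosed s) (hs' : IsClosed s')
    (h : IsIntegralCurveOn γ v s) (h' : IsIntegralCurveOn γ v s') :
    IsIntegralCurveOn γ v (s ∪ s') := by
  have extend {u : Set ℝ} (hu : IsClosed u) (hγ : IsIntegralCurveOn γ v u) (t : ℝ) :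
      HasDerivWithinAt γ (v t (γ t)) u t := by
    by_cases ht : t ∈ u
    · exact hγ t ht
    · exact HasFDerivWithinAt.of_notMem_closure (hu.closure_eq.symm ▸ ht)
  exact fun t _ => (extend hs h t).union (extend hs' h' t)

theorem isIntegralCurveOn_Icc_ite (hab : a ≤ b) (hbc : b ≤ c)
    (hα : IsIntegralCurveOn α v (Icc a b)) (hβ : IsIntegralCurveOn β v (Icc b c))
    (heq : α b = β b) :
    IsIntegralCurveOn (fun t => if t ≤ b then α t else β t) v (Icc a c) := by
  rw [← Icc_union_Icc_eq_Icc hab hbc]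
  refine isIntegralCurveOn_union isClosed_Icc isClosed_Icc
    (isIntegralCurveOn_congr hα fun t ht => if_pos ht.2) (isIntegralCurveOn_congr hβ fun t ht => ?_)
  rcases ht.1.eq_or_lt with rfl | hlt
  · exact (if_pos le_rfl).trans heq
  · exact if_neg hlt.not_ge

variable {L : ℝ → E →L[ℝ] E} {K : ℝ≥0}

theorem exists_nnnorm_le_of_continuousOn {X F : Type*} [TopologicalSpace X]
    [SeminormedAddCommGroup F] {f : X → F} {u : Set X} (hu : IsCompact u)
    (hf : ContinuousOn f u) : ∃ K : ℝ≥0, ∀ x ∈ u, ‖f x‖₊ ≤ K := by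
  obtain ⟨C, hC⟩ := hu.exists_bound_of_continuousOn hf
  exact ⟨C.toNNReal, fun t ht => (hC t ht).trans (Real.le_coe_toNNReal C)⟩

section Existence

variable [CompleteSpace E]

theorem exists_isIntegralCurveOn_linear_of_mul_sub_le (hab : a ≤ b)
    (hstep : K * (b - a) ≤ 1 / 2) (hL : ContinuousOn L (Icc a b))
    (hK : ∀ t ∈ Icc a b, ‖L t‖₊ ≤ K) (x₀ : E) :
    ∃ x : ℝ → E, x a = x₀ ∧ IsIntegralCurveOn x (fun t => L t) (Icc a b) := by
  have hpl : IsPicardLindelof (fun t => L t) (⟨a, left_mem_Icc.2 hab⟩ : Icc a b) x₀ ‖x₀‖₊ 0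
      (K * (2 * ‖x₀‖₊)) K :=
    { lipschitzOnWith := fun t ht => ((L t).lipschitz.weaken (hK t ht)).lipschitzOnWith
      continuousOn := fun x _ => hL.clm_apply continuousOn_const
      norm_le := fun t ht x hx => by
        have hx' : ‖x‖ ≤ 2 * ‖x₀‖ := by
          have := norm_le_norm_add_norm_sub' x x₀
          rw [mem_closedBall_iff_norm, coe_nnnorm] at hx
          linarith
        exact (L t).le_of_opNorm_le_of_le (hK t ht) hx'
      mul_max_le := by
        have := mul_le_mul_of_nonneg_right hstep (norm_nonneg x₀)
        simp only [sub_self, max_eq_left (sub_nonneg.2 hab)]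
        push_cast
        linarith }
  exact hpl.exists_eq_forall_mem_Icc_hasDerivWithinAt₀

theorem exists_isIntegralCurveOn_linear (hab : a ≤ b) (hL : ContinuousOn L (Icc a b)) (x₀ : E) :
    ∃ x : ℝ → E, x a = x₀ ∧ IsIntegralCurveOn x (fun t => L t) (Icc a b) := by
  obtain ⟨K, hK⟩ := exists_nnnorm_le_of_continuousOn isCompact_Icc hL
  obtain ⟨h, hpos, hstep⟩ : ∃ h > (0 : ℝ), K * h ≤ 1 / 2 :=
    ⟨1 / (2 * (K + 1)), by positivity, by field_simp; linarith⟩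
  obtain ⟨N, hN⟩ := Archimedean.arch (b - a) hpos
  suffices key : ∀ m : ℕ, ∀ c ∈ Icc a b, c - a ≤ m • h →
      ∃ x : ℝ → E, x a = x₀ ∧ IsIntegralCurveOn x (fun t => L t) (Icc a c) from
    key N b (right_mem_Icc.2 hab) hN
  intro m
  induction m with
  | zero =>
    intro c hc hle
    obtain rfl : c = a := by linarith [hc.1, zero_smul ℕ h]
    exact exists_isIntegralCurveOn_linear_of_mul_sub_le le_rfl (by simp)
      (hL.mono (Icc_subset_Icc_right hc.2)) (fun t ht => hK t ⟨ht.1, ht.2.trans hc.2⟩) x₀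
  | succ m ih =>
    intro c hc hle
    obtain ⟨d, had, hdc, hcd, hdm⟩ : ∃ d, a ≤ d ∧ d ≤ c ∧ c - d ≤ h ∧ d - a ≤ m • h := by
      rw [succ_nsmul] at hle
      exact ⟨max a (c - h), le_max_left _ _, max_le hc.1 (by linarith),
        by linarith [le_max_right a (c - h)],
        sub_le_iff_le_add.2 (max_le (by linarith [nsmul_nonneg hpos.le m]) (by linarith))⟩
    obtain ⟨x, hx₀, hx⟩ := ih d ⟨had, hdc.trans hc.2⟩ hdm
    obtain ⟨y, hy₀, hy⟩ := exists_isIntegralCurveOn_linear_of_mul_sub_le hdc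
      ((mul_le_mul_of_nonneg_left hcd K.2).trans hstep) (hL.mono (Icc_subset_Icc had hc.2))
      (fun t ht => hK t ⟨had.trans ht.1, ht.2.trans hc.2⟩) (x d)
    exact ⟨_, (if_pos had).trans hx₀, isIntegralCurveOn_Icc_ite had hdc hx hy hy₀.symm⟩

end Existence

theorem eqOn_of_isIntegralCurveOn_linear (hL : ContinuousOn L (Icc a b))
    (hα : IsIntegralCurveOn α (fun t => L t) (Icc a b))
    (hβ : IsIntegralCurveOn β (fun t => L t) (Icc a b)) (heq : α a = β a) :
    EqOn α β (Icc a b) := by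
  obtain ⟨K, hK⟩ := exists_nnnorm_le_of_continuousOn isCompact_Icc hL
  have right_deriv {x : ℝ → E} (hx : IsIntegralCurveOn x (fun t => L t) (Icc a b)) (t : ℝ)
      (ht : t ∈ Ico a b) : HasDerivWithinAt x (L t (x t)) (Ici t) t :=
    (hx t (Ico_subset_Icc_self ht)).mono_of_mem_nhdsWithin
      (Filter.mem_of_superset (Icc_mem_nhdsGE ht.2) (Icc_subset_Icc_left ht.1))
  exact ODE_solution_unique_of_mem_Icc_right (s := fun _ => univ)
    (fun t ht => ((L t).lipschitz.weaken (hK t (Ico_subset_Icc_self ht))).lipschitzOnWith)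
    hα.continuousOn (right_deriv hα) (fun _ _ => mem_univ _)
    hβ.continuousOn (right_deriv hβ) (fun _ _ => mem_univ _) heq

theorem contDiffOn_of_isIntegralCurveOn_linear {m : ℕ∞} (hab : a < b)
    (hL : ContDiffOn ℝ m L (Icc a b)) (hα : IsIntegralCurveOn α (fun t => L t) (Icc a b)) :
    ContDiffOn ℝ (m + 1) α (Icc a b) := by
  have hu := uniqueDiffOn_Icc hab
  rw [← WithTop.coe_one, ← WithTop.coe_add, contDiffOn_iff_forall_nat_le]
  intro j
  induction j with
  | zero => exact fun _ => contDiffOn_zero.2 hα.continuousOn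
  | succ j ih =>
    intro hj
    have hjm : (j : ℕ∞) ≤ m := (ENat.add_le_add_iff_right ENat.one_ne_top).1 (by exact_mod_cast hj)
    refine (contDiffOn_succ_iff_derivWithin hu (n := j)).2
      ⟨fun t ht => (hα t ht).differentiableWithinAt, by simp, ?_⟩
    exact ((hL.of_le (by exact_mod_cast hjm)).clm_apply (ih (hjm.trans le_self_add))).congr
      fun t ht => (hα t ht).derivWithin (hu t ht)

end LinearODE

section UnitaryFlow

variable {𝔸 : Type*} [NormedRing 𝔸] [NormedAlgebra ℝ 𝔸] {G V W : ℝ → 𝔸} {a b : ℝ}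

theorem exists_contDiffOn_isIntegralCurveOn_mul [CompleteSpace 𝔸] {m : ℕ∞} (hab : a < b)
    (hG : ContDiffOn ℝ m G (Icc a b)) (V₀ : 𝔸) :
    ∃ V : ℝ → 𝔸, ContDiffOn ℝ (m + 1) V (Icc a b) ∧ V a = V₀ ∧
      IsIntegralCurveOn V (fun t X => G t * X) (Icc a b) := by
  have hL : ContDiffOn ℝ m (fun t => ContinuousLinearMap.mul ℝ 𝔸 (G t)) (Icc a b) :=
    (ContinuousLinearMap.mul ℝ 𝔸).contDiff.comp_contDiffOn hG
  obtain ⟨V, hV₀, hV⟩ := exists_isIntegralCurveOn_linear hab.le hL.continuousOn V₀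
  exact ⟨V, contDiffOn_of_isIntegralCurveOn_linear hab hL hV, hV₀, hV⟩

theorem eqOn_of_isIntegralCurveOn_mul (hG : ContinuousOn G (Icc a b))
    (hV : IsIntegralCurveOn V (fun t X => G t * X) (Icc a b))
    (hW : IsIntegralCurveOn W (fun t X => G t * X) (Icc a b)) (h : V a = W a) :
    EqOn V W (Icc a b) :=
  eqOn_of_isIntegralCurveOn_linear (L := fun t => ContinuousLinearMap.mul ℝ 𝔸 (G t))
    ((ContinuousLinearMap.mul ℝ 𝔸).continuous.comp_continuousOn hG) hV hW h

variable [StarRing 𝔸] [ContinuousStar 𝔸] [StarModule ℝ 𝔸]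

theorem star_mul_self_eq_one_of_isIntegralCurveOn_mul (hab : a < b)
    (hG : ∀ t ∈ Icc a b, star (G t) = -G t)
    (hV : IsIntegralCurveOn V (fun t X => G t * X) (Icc a b)) (h : star (V a) * V a = 1) :
    ∀ t ∈ Icc a b, star (V t) * V t = 1 := by
  have hderiv (t) (ht : t ∈ Icc a b) :
      HasDerivWithinAt (fun s => star (V s) * V s) 0 (Icc a b) t := by
    have hzero : star (G t * V t) * V t + star (V t) * (G t * V t) = 0 := by
      rw [star_mul, hG t ht]
      noncomm_ring
    exact hzero ▸ (hV t ht).star.mul (hV t ht)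
  intro t ht
  rw [← h]
  exact constant_of_derivWithin_zero (fun t ht => (hderiv t ht).differentiableWithinAt)
    (fun t ht => (hderiv t (Ico_subset_Icc_self ht)).derivWithin
      (uniqueDiffOn_Icc hab t (Ico_subset_Icc_self ht))) t ht

end UnitaryFlow

section KatoTransport

variable {ι : Type*}

theorem deriv_mul_add_mul_deriv_of_orthogonalIdempotents [DecidableEq ι] {𝔸 : Type*}
    [NormedRing 𝔸] [NormedAlgebra ℝ 𝔸] {P : ι → ℝ → 𝔸} {P' : ι → 𝔸} {s : Set ℝ}
    {t : ℝ} (ht : t ∈ s) (hu : UniqueDiffWithinAt ℝ s t)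
    (hP : ∀ r ∈ s, OrthogonalIdempotents (P · r))
    (hd : ∀ j, HasDerivWithinAt (P j) (P' j) s t) (j l : ι) :
    P' j * P l t + P j t * P' l = if j = l then P' j else 0 := by
  refine hu.eq_deriv _ ((hd j).mul (hd l)) ?_
  split_ifs with hjl
  · subst hjl
    exact (hd j).congr (fun r hr => (hP r hr).idem j) ((hP t ht).idem j)
  · exact (hasDerivWithinAt_const t s 0).congr (fun r hr => (hP r hr).ortho hjl)
      ((hP t ht).ortho hjl)

variable [Fintype ι]

/-- The generator `∑ Pₗ' Pₗ` of Kato's parallel transport along a path of complete systems of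
orthogonal projections `Pₗ` with velocities `Pₗ'`. -/
def katoGenerator {R : Type*} [Ring R] (P P' : ι → R) : R := ∑ l, P' l * P l

theorem eq_katoGenerator_commutator [DecidableEq ι] {R : Type*} [Ring R] {P P' : ι → R}
    (hP : CompleteOrthogonalIdempotents P)
    (hP' : ∀ j l, P' j * P l + P j * P' l = if j = l then P' j else 0) (j : ι) :
    P' j = katoGenerator P P' * P j - P j * katoGenerator P P' := by
  have hleft : katoGenerator P P' * P j = P' j * P j := by
    simp only [katoGenerator, Finset.sum_mul, mul_assoc, hP.mul_eq, mul_ite, mul_zero,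
      Finset.sum_ite_eq', Finset.mem_univ, if_true]
  have hterm (l) : P j * (P' l * P l) = (if j = l then P' j * P l else 0) - P' j * P l := by
    rw [← mul_assoc, eq_sub_of_add_eq' (hP' j l), sub_mul, mul_assoc, (hP.idem l).eq, ite_mul,
      zero_mul]
  have hright : P j * katoGenerator P P' = P' j * P j - P' j := by
    simp only [katoGenerator, Finset.mul_sum, hterm, Finset.sum_sub_distrib, Finset.sum_ite_eq,
      Finset.mem_univ, if_true]
    rw [← Finset.mul_sum, hP.complete, mul_one]
  rw [hleft, hright, sub_sub_cancel]

theorem star_katoGenerator {R : Type*} [Ring R] [StarRing R] [DecidableEq ι] {P P' : ι → R}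
    (hsa : ∀ j, IsSelfAdjoint (P j)) (hsa' : ∀ j, IsSelfAdjoint (P' j))
    (hP' : ∀ j l, P' j * P l + P j * P' l = if j = l then P' j else 0) (hsum : ∑ j, P' j = 0) :
    star (katoGenerator P P') = -katoGenerator P P' := by
  rw [eq_neg_iff_add_eq_zero, katoGenerator, star_sum, ← Finset.sum_add_distrib, ← hsum]
  refine Finset.sum_congr rfl fun j _ => ?_
  rw [star_mul, (hsa j).star_eq, (hsa' j).star_eq, add_comm, hP', if_pos rfl]

variable {𝔸 : Type*} [NormedRing 𝔸] [NormedAlgebra ℝ 𝔸] [CompleteSpace 𝔸] [StarRing 𝔸]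
  [ContinuousStar 𝔸] [StarModule ℝ 𝔸] {a b : ℝ} {m : ℕ∞} {P : ι → ℝ → 𝔸}

theorem exists_katoTransport (hab : a < b)
    (hPd : ∀ j, ContDiffOn ℝ (m + 1) (P j) (Icc a b))
    (hP : ∀ t ∈ Icc a b, CompleteOrthogonalIdempotents (P · t))
    (hsa : ∀ t ∈ Icc a b, ∀ j, IsSelfAdjoint (P j t)) :
    ∃ T : ℝ → 𝔸, ContDiffOn ℝ (m + 1) T (Icc a b) ∧ T a = 1 ∧
      ∀ t ∈ Icc a b, star (T t) * T t = 1 ∧ ∀ j, P j t * T t = T t * P j a := by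
  classical
  have hu := uniqueDiffOn_Icc hab
  set P' : ι → ℝ → 𝔸 := fun j => derivWithin (P j) (Icc a b)
  have hderiv j t (ht : t ∈ Icc a b) : HasDerivWithinAt (P j) (P' j t) (Icc a b) t :=
    ((hPd j).differentiableOn (by simp) t ht).hasDerivWithinAt
  have hmul t (ht : t ∈ Icc a b) j l :
      P' j t * P l t + P j t * P' l t = if j = l then P' j t else 0 :=
    deriv_mul_add_mul_deriv_of_orthogonalIdempotents ht (hu t ht)
      (fun r hr => (hP r hr).toOrthogonalIdempotents) (fun j => hderiv j t ht) j l
  have hsum t (ht : t ∈ Icc a b) : ∑ j, P' j t = 0 := by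
    refine (hu t ht).eq_deriv _ (HasDerivWithinAt.fun_sum fun j _ => hderiv j t ht) ?_
    exact (hasDerivWithinAt_const t _ 1).congr (fun s hs => (hP s hs).complete) (hP t ht).complete
  have hsa' t (ht : t ∈ Icc a b) j : IsSelfAdjoint (P' j t) :=
    (hu t ht).eq_deriv _ ((hderiv j t ht).star.congr (fun s hs => (hsa s hs j).star_eq.symm)
      (hsa t ht j).star_eq.symm) (hderiv j t ht)
  set G : ℝ → 𝔸 := fun t => katoGenerator (P · t) (P' · t)
  have hGd : ContDiffOn ℝ m G (Icc a b) := ContDiffOn.sum fun j _ =>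
    ((hPd j).derivWithin hu le_rfl).mul ((hPd j).of_le le_self_add)
  obtain ⟨T, hTd, hTa, hT⟩ := exists_contDiffOn_isIntegralCurveOn_mul hab hGd 1
  refine ⟨T, hTd, hTa, fun t ht => ⟨?_, fun j => ?_⟩⟩
  · exact star_mul_self_eq_one_of_isIntegralCurveOn_mul hab
      (fun s hs => star_katoGenerator (hsa s hs) (hsa' s hs) (hmul s hs) (hsum s hs)) hT
      (by simp [hTa]) t ht
  · refine eqOn_of_isIntegralCurveOn_mul hGd.continuousOn (V := fun s => P j s * T s)
      (W := fun s => T s * P j a) (fun s hs => ?_) (fun s hs => ?_) (by simp [hTa]) ht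
    · have hcomm : P' j s = G s * P j s - P j s * G s :=
        eq_katoGenerator_commutator (hP s hs) (hmul s hs) j
      have hvel : P' j s * T s + P j s * (G s * T s) = G s * (P j s * T s) := by
        rw [hcomm]
        noncomm_ring
      exact ((hderiv j s hs).mul (hT s hs)).congr_deriv hvel
    · exact ((hT s hs).mul_const (P j a)).congr_deriv (mul_assoc (G s) (T s) (P j a))

end KatoTransport

attribute [local instance] Matrix.frobeniusNormedRing Matrix.frobeniusNormedAlgebra

section Eigendecomposition

open Polynomial

variable {ι : Type*} [Fintype ι] [DecidableEq ι] {B V W : Matrix ι ι ℂ} {d : ι → ℝ}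

/-- `B = V diag(d) V*` with `V` unitary: an eigendecomposition of the Hermitian matrix `B`, whose
eigenvalues are listed in a prescribed order. -/
structure IsEigendecomposition (B V : Matrix ι ι ℂ) (d : ι → ℝ) : Prop where
  unitary : V ∈ Matrix.unitaryGroup ι ℂ
  eq : B = V * diagonal (fun j => (d j : ℂ)) * Vᴴ

namespace IsEigendecomposition

theorem charpoly_eq (h : IsEigendecomposition B V d) : B.charpoly = ∏ j, (X - C (d j : ℂ)) := by
  rw [h.eq, Matrix.charpoly_mul_comm, ← Matrix.mul_assoc, ← star_eq_conjTranspose,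
    Matrix.mem_unitaryGroup_iff'.1 h.unitary, Matrix.one_mul, Matrix.charpoly_diagonal]

theorem roots_charpoly (h : IsEigendecomposition B V d) :
    B.charpoly.roots = Finset.univ.val.map fun j => (d j : ℂ) := by
  rw [h.charpoly_eq]
  exact roots_multiset_prod_X_sub_C (Finset.univ.val.map fun j => (d j : ℂ)) ▸
    by rw [Multiset.map_map]; rfl

theorem isRoot_charpoly_iff (h : IsEigendecomposition B V d) {z : ℂ} :
    B.charpoly.IsRoot z ↔ ∃ j, z = d j := by
  simp [h.charpoly_eq, IsRoot.def, eval_prod, Finset.prod_eq_zero_iff, sub_eq_zero]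

theorem eval_derivative_charpoly_ne_zero (h : IsEigendecomposition B V d)
    (hd : Function.Injective d) (j : ι) : B.charpoly.derivative.eval (d j : ℂ) ≠ 0 := by
  have hsep : B.charpoly.Separable := by
    rw [h.charpoly_eq, separable_prod_X_sub_C_iff]
    exact Complex.ofReal_injective.comp hd
  exact hsep.eval₂_derivative_ne_zero (RingHom.id ℂ) (h.isRoot_charpoly_iff.2 ⟨j, rfl⟩)

end IsEigendecomposition

/-- The algebra homomorphism `c ↦ V diag(c) V*`: the polynomial functional calculus of a matrix
with eigenvector matrix `V` factors through it. -/
def conjDiagonal (V : Matrix.unitaryGroup ι ℂ) : (ι → ℂ) →ₐ[ℂ] Matrix ι ι ℂ :=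
  (Unitary.conjStarAlgAut ℂ (Matrix ι ι ℂ) V).toAlgEquiv.toAlgHom.comp (Matrix.diagonalAlgHom ℂ)

theorem conjDiagonal_apply (V : Matrix.unitaryGroup ι ℂ) (c : ι → ℂ) :
    conjDiagonal V c = V * diagonal c * (V : Matrix ι ι ℂ)ᴴ := rfl

theorem sum_smul_conjDiagonal_single (V : Matrix.unitaryGroup ι ℂ) (c : ι → ℂ) :
    ∑ j, c j • conjDiagonal V (Pi.single j 1) = conjDiagonal V c := by
  simp only [← map_smul, ← map_sum, ← Pi.single_smul, smul_eq_mul, mul_one,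
    Finset.univ_sum_single]

/-- The projection onto the eigenspace of `d j` for a matrix `B` with the distinct eigenvalues `d`,
written as an interpolation polynomial in `B` so that it depends smoothly on `B` and `d`. -/
def spectralProjection (B : Matrix ι ι ℂ) (d : ι → ℝ) (j : ι) : Matrix ι ι ℂ :=
  aeval B (Lagrange.basis Finset.univ (fun l => (d l : ℂ)) j)

namespace IsEigendecomposition

theorem aeval_eq (h : IsEigendecomposition B V d) (p : ℂ[X]) :
    aeval B p = conjDiagonal ⟨V, h.unitary⟩ fun j => p.eval (d j : ℂ) := by
  have hB : B = conjDiagonal ⟨V, h.unitary⟩ fun j => (d j : ℂ) := h.eq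
  conv_lhs => rw [hB, aeval_algHom_apply, aeval_pi]
  rfl

theorem spectralProjection_eq (h : IsEigendecomposition B V d) (hd : Function.Injective d)
    (j : ι) : spectralProjection B d j = conjDiagonal ⟨V, h.unitary⟩ (Pi.single j 1) := by
  have hinj : InjOn (fun l => (d l : ℂ)) (Finset.univ : Finset ι) :=
    (Complex.ofReal_injective.comp hd).injOn
  rw [spectralProjection, h.aeval_eq]
  congr 1
  funext l
  obtain rfl | hlj := eq_or_ne l j
  · rw [Pi.single_eq_same]
    exact Lagrange.eval_basis_self hinj (Finset.mem_univ l)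
  · rw [Pi.single_eq_of_ne hlj]
    exact Lagrange.eval_basis_of_ne (v := fun l => (d l : ℂ)) hlj.symm (Finset.mem_univ l)

theorem completeOrthogonalIdempotents (h : IsEigendecomposition B V d)
    (hd : Function.Injective d) : CompleteOrthogonalIdempotents (spectralProjection B d) := by
  rw [funext (h.spectralProjection_eq hd)]
  exact (CompleteOrthogonalIdempotents.single fun _ : ι => ℂ).map
    (conjDiagonal ⟨V, h.unitary⟩).toRingHom

theorem isSelfAdjoint_spectralProjection (h : IsEigendecomposition B V d)
    (hd : Function.Injective d) (j : ι) : IsSelfAdjoint (spectralProjection B d j) := by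
  rw [h.spectralProjection_eq hd, conjDiagonal_apply]
  exact (Matrix.IsHermitian.isSelfAdjoint (by simp [IsHermitian, diagonal_single])).conjugate V

theorem spectralProjection_mul (h : IsEigendecomposition B V d) (hd : Function.Injective d)
    (j : ι) : spectralProjection B d j * V = V * diagonal (Pi.single j 1) := by
  rw [h.spectralProjection_eq hd, conjDiagonal_apply, Matrix.mul_assoc, ← star_eq_conjTranspose,
    Matrix.mem_unitaryGroup_iff'.1 h.unitary, Matrix.mul_one]

theorem of_spectralProjection_mul (h : IsEigendecomposition B V d) (hd : Function.Injective d)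
    (hW : W ∈ Matrix.unitaryGroup ι ℂ)
    (hBW : ∀ j, spectralProjection B d j * W = W * diagonal (Pi.single j 1)) :
    IsEigendecomposition B W d where
  unitary := hW
  eq := by
    have hproj (j) : spectralProjection B d j = conjDiagonal ⟨W, hW⟩ (Pi.single j 1) := by
      rw [conjDiagonal_apply, ← hBW, Matrix.mul_assoc, ← star_eq_conjTranspose,
        Matrix.mem_unitaryGroup_iff.1 hW, Matrix.mul_one]
    calc B = conjDiagonal ⟨V, h.unitary⟩ fun j => (d j : ℂ) := h.eq
      _ = ∑ j, (d j : ℂ) • spectralProjection B d j := by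
        simp only [h.spectralProjection_eq hd, sum_smul_conjDiagonal_single]
      _ = conjDiagonal ⟨W, hW⟩ fun j => (d j : ℂ) := by
        simp only [hproj, sum_smul_conjDiagonal_single]

end IsEigendecomposition

end Eigendecomposition

section SmoothEigendecomposition

open Polynomial
open scoped Topology ContDiff

variable {ι : Type*} [Fintype ι] [DecidableEq ι]

theorem contDiff_det {𝕜 : Type*} [RCLike 𝕜] {k : WithTop ℕ∞} :
    ContDiff 𝕜 k (det : Matrix ι ι 𝕜 → 𝕜) := by
  have hentry (i j : ι) : ContDiff 𝕜 k fun M : Matrix ι ι 𝕜 => M i j :=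
    (Matrix.entryLinearMap 𝕜 𝕜 i j).toContinuousLinearMap.contDiff
  rw [show det = _ from _root_.funext (Matrix.det_apply (R := 𝕜) (n := ι))]
  exact ContDiff.sum fun π _ => (contDiff_prod fun i _ => hentry _ _).const_smul _

theorem exists_contDiffAt_isRoot_charpoly {𝕜 : Type*} [RCLike 𝕜] {M₀ : Matrix ι ι 𝕜} {z₀ : 𝕜}
    (hroot : M₀.charpoly.IsRoot z₀) (hsimple : M₀.charpoly.derivative.eval z₀ ≠ 0) :
    ∃ g : Matrix ι ι 𝕜 → 𝕜, ContDiffAt 𝕜 ∞ g M₀ ∧ g M₀ = z₀ ∧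
      ∀ᶠ M in 𝓝 M₀, M.charpoly.IsRoot (g M) := by
  set Φ : Matrix ι ι 𝕜 × 𝕜 → 𝕜 := fun p => (scalar ι p.2 - p.1).det
  have hΦ p : Φ p = p.1.charpoly.eval p.2 := (p.1.eval_charpoly p.2).symm
  have hscalar : ContDiff 𝕜 ∞ (scalar ι : 𝕜 → Matrix ι ι 𝕜) :=
    (Algebra.linearMap 𝕜 (Matrix ι ι 𝕜)).toContinuousLinearMap.contDiff
  have hΦd : ContDiffAt 𝕜 ∞ Φ (M₀, z₀) :=
    (contDiff_det.comp ((hscalar.comp contDiff_snd).sub contDiff_fst)).contDiffAt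
  have hpartial : fderiv 𝕜 Φ (M₀, z₀) (0, 1) = M₀.charpoly.derivative.eval z₀ := by
    have hcomp : HasDerivAt (fun z => Φ (M₀, z)) (fderiv 𝕜 Φ (M₀, z₀) (0, 1)) z₀ :=
      (hΦd.differentiableAt (by simp)).hasFDerivAt.comp_hasDerivAt z₀
        ((hasDerivAt_const z₀ M₀).prodMk (hasDerivAt_id z₀))
    simp only [hΦ] at hcomp
    exact hcomp.unique (M₀.charpoly.hasDerivAt z₀)
  have hinv : (fderiv 𝕜 Φ (M₀, z₀) ∘L .inr 𝕜 (Matrix ι ι 𝕜) 𝕜).IsInvertible := by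
    refine ⟨ContinuousLinearEquiv.unitsEquivAut 𝕜 (Units.mk0 _ hsimple), ?_⟩
    ext
    simp [hpartial]
  have hne : (∞ : WithTop ℕ∞) ≠ 0 := by simp
  refine ⟨hΦd.implicitFunction hne hinv, hΦd.contDiffAt_implicitFunction hne hinv,
    hΦd.implicitFunction_apply_self hne hinv, ?_⟩
  filter_upwards [hΦd.eventually_apply_implicitFunction hne hinv] with M hM
  exact (hΦ _).symm.trans (hM.trans ((hΦ _).trans hroot))

theorem eq_of_strictAnti_of_forall_exists_eq {n : ℕ} {α : Type*} [LinearOrder α] {f g : Fin n → α}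
    (hf : StrictAnti f) (hg : StrictAnti g) (h : ∀ l, ∃ i, f l = g i) : f = g := by
  choose φ hφ using h
  have hmono : StrictMono φ := fun i j hij => hg.lt_iff_gt.1 (hφ i ▸ hφ j ▸ hf hij)
  have hφid : φ = id := (StrictMono.range_inj hmono strictMono_id).1 <| by
    rw [range_id, (Finite.injective_iff_surjective.1 hmono.injective).range_eq]
  ext l
  simpa [hφid] using hφ l

variable {E : Type*} [NormedAddCommGroup E] [NormedSpace ℝ E] {s : Set E} {k : ℕ∞}

theorem contDiffOn_eigenvalues {n : ℕ} {B V : E → Matrix (Fin n) (Fin n) ℂ} {d : E → Fin n → ℝ}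
    (hB : ContDiffOn ℝ k B s) (hd : ∀ x ∈ s, StrictAnti (d x))
    (hBV : ∀ x ∈ s, IsEigendecomposition (B x) (V x) (d x)) : ContDiffOn ℝ k d s := by
  intro x₀ hx₀
  have hdec := hBV x₀ hx₀
  choose g hg hg₀ hroot using fun j => exists_contDiffAt_isRoot_charpoly
    (hdec.isRoot_charpoly_iff.2 ⟨j, rfl⟩)
    (hdec.eval_derivative_charpoly_ne_zero (hd x₀ hx₀).injective j)
  set e : E → Fin n → ℝ := fun x j => (g j (B x)).re
  have he₀ : e x₀ = d x₀ := _root_.funext fun j => by simp [e, hg₀]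
  have he : ContDiffWithinAt ℝ k e s x₀ := contDiffWithinAt_pi.2 fun j =>
    Complex.reCLM.contDiff.contDiffAt.comp_contDiffWithinAt x₀ <|
      (((hg j).restrict_scalars ℝ).of_le (by exact_mod_cast le_top)).comp_contDiffWithinAt x₀
        (hB x₀ hx₀)
  have hanti : ∀ᶠ x in 𝓝[s] x₀, StrictAnti (e x) := by
    refine Filter.eventually_all.2 fun i => Filter.eventually_all.2 fun j => ?_
    by_cases hij : i < j
    · have hlt : e x₀ j < e x₀ i := he₀ ▸ hd x₀ hx₀ hij
      have hcont (l) := (contDiffWithinAt_pi.1 he l).continuousWithinAt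
      exact ((hcont j).eventually_lt (hcont i) hlt).mono fun _ h _ => h
    · exact Filter.Eventually.of_forall fun _ h => absurd h hij
  have hroots : ∀ᶠ x in 𝓝[s] x₀, ∀ j, (B x).charpoly.IsRoot (g j (B x)) :=
    Filter.eventually_all.2 fun j => (hB x₀ hx₀).continuousWithinAt.eventually (hroot j)
  refine he.congr_of_eventuallyEq ?_ he₀.symm
  filter_upwards [hanti, hroots, self_mem_nhdsWithin] with x hex hrx hx
  refine eq_of_strictAnti_of_forall_exists_eq hex (hd x hx) (fun j => ?_) |>.symm
  exact ((hBV x hx).isRoot_charpoly_iff.1 (hrx j)).imp fun i hi => by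
    simp [e, hi]

theorem contDiffOn_spectralProjection {B : E → Matrix ι ι ℂ} {d : E → ι → ℝ}
    (hB : ContDiffOn ℝ k B s) (hd : ContDiffOn ℝ k d s)
    (hinj : ∀ x ∈ s, Function.Injective (d x)) (j : ι) :
    ContDiffOn ℝ k (fun x => spectralProjection (B x) (d x) j) s := by
  have hdc (l : ι) : ContDiffOn ℝ k (fun x => (d x l : ℂ)) s :=
    Complex.ofRealCLM.contDiff.comp_contDiffOn (contDiffOn_pi.1 hd l)
  have hfactor (l : ι) (hl : l ≠ j) :
      ContDiffOn ℝ k (fun x => aeval (B x) (Lagrange.basisDivisor (d x j : ℂ) (d x l))) s := by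
    simp only [Lagrange.basisDivisor, map_mul, map_sub, aeval_C, aeval_X]
    have hne x (hx : x ∈ s) : (d x j - d x l : ℂ) ≠ 0 := by
      exact_mod_cast sub_ne_zero.2 ((hinj x hx).ne hl.symm)
    have halg : ContDiff ℝ k (algebraMap ℂ (Matrix ι ι ℂ)) :=
      ((Algebra.linearMap ℂ (Matrix ι ι ℂ)).restrictScalars ℝ).toContinuousLinearMap.contDiff
    exact (halg.comp_contDiffOn (((hdc j).sub (hdc l)).inv hne)).mul
      (hB.sub (halg.comp_contDiffOn (hdc l)))
  have hprod (u : Finset ι) (hu : j ∉ u) : ContDiffOn ℝ k (fun x =>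
      aeval (B x) (∏ l ∈ u, Lagrange.basisDivisor (d x j : ℂ) (d x l))) s := by
    induction u using Finset.induction_on with
    | empty => simpa using contDiffOn_const
    | insert l u hlu ih =>
      simp only [Finset.prod_insert hlu, map_mul]
      rw [Finset.mem_insert, not_or] at hu
      exact (hfactor l (Ne.symm hu.1)).mul (ih hu.2)
  exact hprod _ (Finset.notMem_erase j _)

theorem exists_contDiffOn_isEigendecomposition {a b : ℝ} (hab : a < b) {B : ℝ → Matrix ι ι ℂ}
    {d : ℝ → ι → ℝ} {V₀ : Matrix ι ι ℂ} (hB : ContDiffOn ℝ (k + 1) B (Icc a b))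
    (hd : ContDiffOn ℝ (k + 1) d (Icc a b)) (hinj : ∀ t ∈ Icc a b, Function.Injective (d t))
    (hdec : ∀ t ∈ Icc a b, ∃ W, IsEigendecomposition (B t) W (d t))
    (hV₀ : IsEigendecomposition (B a) V₀ (d a)) :
    ∃ V : ℝ → Matrix ι ι ℂ, ContDiffOn ℝ (k + 1) V (Icc a b) ∧ V a = V₀ ∧
      ∀ t ∈ Icc a b, IsEigendecomposition (B t) (V t) (d t) := by
  choose! W hW using hdec
  obtain ⟨T, hTd, hTa, hT⟩ := exists_katoTransport hab
    (P := fun j t => spectralProjection (B t) (d t) j)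
    (contDiffOn_spectralProjection hB hd hinj)
    (fun t ht => (hW t ht).completeOrthogonalIdempotents (hinj t ht))
    (fun t ht => (hW t ht).isSelfAdjoint_spectralProjection (hinj t ht))
  refine ⟨fun t => T t * V₀, hTd.mul contDiffOn_const, by simp [hTa], fun t ht => ?_⟩
  refine (hW t ht).of_spectralProjection_mul (hinj t ht)
    (mul_mem (Matrix.mem_unitaryGroup_iff'.2 (hT t ht).1) hV₀.unitary) fun j => ?_
  rw [← Matrix.mul_assoc, (hT t ht).2 j, Matrix.mul_assoc,
    hV₀.spectralProjection_mul (hinj a (left_mem_Icc.2 hab.le)), Matrix.mul_assoc]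

end SmoothEigendecomposition

section SingularValues

variable {n : ℕ} {A B U V W : Matrix (Fin n) (Fin n) ℂ} {σ τ : Fin n → ℝ}

theorem eq_of_antitone_of_map_univ_eq {α : Type*} [PartialOrder α] {f g : Fin n → α}
    (hf : Antitone f) (hg : Antitone g)
    (h : Finset.univ.val.map f = Finset.univ.val.map g) : f = g := by
  have hperm : (List.ofFn f).Perm (List.ofFn g) := by
    rw [← Multiset.coe_eq_coe]
    simpa [Fin.univ_val_map] using h
  exact List.ofFn_injective <| hperm.eq_of_pairwise' (r := (· ≥ ·))
    (List.pairwise_ofFn.2 fun _ _ hij => hf hij.le)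
    (List.pairwise_ofFn.2 fun _ _ hij => hg hij.le)

theorem IsEigendecomposition.eq_of_antitone (hV : IsEigendecomposition B V σ)
    (hW : IsEigendecomposition B W τ) (hσ : Antitone σ) (hτ : Antitone τ) : σ = τ := by
  have hroots := congrArg (Multiset.map Complex.re)
    (hV.roots_charpoly.symm.trans hW.roots_charpoly)
  exact eq_of_antitone_of_map_univ_eq hσ hτ (by simpa [Function.comp_def] using hroots)

theorem strictAnti_sq (hσ : StrictAnti σ) (hpos : ∀ j, 0 < σ j) : StrictAnti (σ ^ 2) :=
  fun _ j hij => pow_lt_pow_left₀ (hσ hij) (hpos j).le two_ne_zero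

theorem singularValue_antitone (A : Matrix (Fin n) (Fin n) ℂ) : Antitone (singularValue A) :=
  fun _ _ hij => (Matrix.toEuclideanLin A).singularValues_antitone hij

theorem singularValue_nonneg (A : Matrix (Fin n) (Fin n) ℂ) : 0 ≤ singularValue A :=
  fun j => (Matrix.toEuclideanLin A).singularValues_nonneg j

theorem exists_isEigendecomposition_conjTranspose_mul_self (A : Matrix (Fin n) (Fin n) ℂ) :
    ∃ V, IsEigendecomposition (Aᴴ * A) V (singularValue A ^ 2) := by
  set T := Matrix.toEuclideanLin A with hT
  have hn : Module.finrank ℂ (EuclideanSpace ℂ (Fin n)) = n := finrank_euclideanSpace_fin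
  set b := T.isSymmetric_adjoint_comp_self.eigenvectorBasis hn with hb
  set e := EuclideanSpace.basisFun (Fin n) ℂ
  have hV : e.toBasis.toMatrix b ∈ Matrix.unitaryGroup (Fin n) ℂ :=
    e.toMatrix_orthonormalBasis_mem_unitary b
  have heigen : Aᴴ * A * e.toBasis.toMatrix b =
      e.toBasis.toMatrix b * diagonal (fun j => (((singularValue A ^ 2) j : ℝ) : ℂ)) := by
    ext i j
    have hbj := T.isSymmetric_adjoint_comp_self.apply_eigenvectorBasis hn j
    rw [← hb, ← T.sq_singularValues_fin hn j, LinearMap.comp_apply, hT,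
      ← Matrix.toEuclideanLin_conjTranspose_eq_adjoint] at hbj
    have hbij := congrArg (fun v : EuclideanSpace ℂ (Fin n) => v i) hbj
    rw [Matrix.mul_diagonal, Matrix.mul_apply]
    simpa [e, Module.Basis.toMatrix_apply, Matrix.toLpLin_apply, Matrix.mulVec, dotProduct,
      singularValue, mul_comm] using hbij
  refine ⟨_, hV, ?_⟩
  have hVV : e.toBasis.toMatrix b * (e.toBasis.toMatrix b)ᴴ = 1 := Matrix.mem_unitaryGroup_iff.1 hV
  rw [← heigen, Matrix.mul_assoc, hVV, Matrix.mul_one]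

theorem sigmaMatrix_mul (σ τ : Fin n → ℝ) :
    sigmaMatrix (σ * τ) = sigmaMatrix σ * sigmaMatrix τ := by
  simp [sigmaMatrix]

theorem conjTranspose_sigmaMatrix (σ : Fin n → ℝ) : (sigmaMatrix σ)ᴴ = sigmaMatrix σ := by
  simp [sigmaMatrix, Matrix.diagonal_conjTranspose, Pi.star_def]

theorem sigmaMatrix_mul_sigmaMatrix_inv (hσ : ∀ j, σ j ≠ 0) :
    sigmaMatrix σ * sigmaMatrix σ⁻¹ = 1 := by
  simp [sigmaMatrix, hσ]

theorem sigmaMatrix_inv_mul_sigmaMatrix (hσ : ∀ j, σ j ≠ 0) :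
    sigmaMatrix σ⁻¹ * sigmaMatrix σ = 1 := by
  simp [sigmaMatrix, hσ]

theorem contDiff_sigmaMatrix {k : WithTop ℕ∞} :
    ContDiff ℝ k (sigmaMatrix : (Fin n → ℝ) → Matrix (Fin n) (Fin n) ℂ) :=
  ((Matrix.diagonalLinearMap (Fin n) ℝ ℂ).comp
    (Complex.ofRealCLM.toLinearMap.compLeft (Fin n))).toContinuousLinearMap.contDiff

namespace IsSVD

theorem conjTranspose_left_mul (h : IsSVD A U σ V) : Uᴴ * U = 1 :=
  Matrix.mem_unitaryGroup_iff'.1 h.unitary_left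

theorem conjTranspose_right_mul (h : IsSVD A U σ V) : Vᴴ * V = 1 :=
  Matrix.mem_unitaryGroup_iff'.1 h.unitary_right

theorem mul_right (h : IsSVD A U σ V) : A * V = U * sigmaMatrix σ := by
  rw [h.eq, Matrix.mul_assoc, h.conjTranspose_right_mul, Matrix.mul_one]

theorem isEigendecomposition (h : IsSVD A U σ V) :
    IsEigendecomposition (Aᴴ * A) V (σ ^ 2) where
  unitary := h.unitary_right
  eq := calc
    Aᴴ * A = V * sigmaMatrix σ * (Uᴴ * U) * sigmaMatrix σ * Vᴴ := by
      rw [h.eq]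
      simp only [Matrix.conjTranspose_mul, Matrix.conjTranspose_conjTranspose,
        conjTranspose_sigmaMatrix, Matrix.mul_assoc]
    _ = V * sigmaMatrix (σ ^ 2) * Vᴴ := by
      rw [h.conjTranspose_left_mul, sq, sigmaMatrix_mul, Matrix.mul_one, Matrix.mul_assoc V]

theorem eq_singularValue (h : IsSVD A U σ V) : σ = singularValue A := by
  obtain ⟨W, hW⟩ := exists_isEigendecomposition_conjTranspose_mul_self A
  have hsq : σ ^ 2 = singularValue A ^ 2 := h.isEigendecomposition.eq_of_antitone hW
    (fun i j hij => pow_le_pow_left₀ (h.nonneg j) (h.antitone hij) 2)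
    (fun i j hij => pow_le_pow_left₀ (singularValue_nonneg A j) (singularValue_antitone A hij) 2)
  ext j
  exact (pow_left_inj₀ (h.nonneg j) (singularValue_nonneg A j) two_ne_zero).1 (congrFun hsq j)

theorem left_eq (h : IsSVD A U σ V) (hσ : ∀ j, σ j ≠ 0) : U = A * V * sigmaMatrix σ⁻¹ := by
  rw [h.mul_right, Matrix.mul_assoc, sigmaMatrix_mul_sigmaMatrix_inv hσ, Matrix.mul_one]

end IsSVD

theorem IsEigendecomposition.isSVD (h : IsEigendecomposition (Aᴴ * A) V (σ ^ 2))
    (hσ : ∀ j, 0 < σ j) (hanti : Antitone σ) : IsSVD A (A * V * sigmaMatrix σ⁻¹) σ V := by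
  have hne j := (hσ j).ne'
  have hVV : Vᴴ * V = 1 := Matrix.mem_unitaryGroup_iff'.1 h.unitary
  have hsq : Vᴴ * (Aᴴ * A) * V = sigmaMatrix σ * sigmaMatrix σ := by
    rw [h.eq, ← sigmaMatrix_mul, ← sq, Matrix.mul_assoc, Matrix.mul_assoc _ Vᴴ V, hVV,
      Matrix.mul_one, ← Matrix.mul_assoc, hVV, Matrix.one_mul, sigmaMatrix]
  refine ⟨Matrix.mem_unitaryGroup_iff'.2 ?_, h.unitary, fun j => (hσ j).le, hanti, ?_⟩
  · calc (A * V * sigmaMatrix σ⁻¹)ᴴ * (A * V * sigmaMatrix σ⁻¹)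
        = sigmaMatrix σ⁻¹ * (Vᴴ * (Aᴴ * A) * V) * sigmaMatrix σ⁻¹ := by
          simp only [Matrix.conjTranspose_mul, conjTranspose_sigmaMatrix, Matrix.mul_assoc]
      _ = 1 := by
          rw [hsq, ← Matrix.mul_assoc, sigmaMatrix_inv_mul_sigmaMatrix hne, Matrix.one_mul,
            sigmaMatrix_mul_sigmaMatrix_inv hne]
  · rw [Matrix.mul_assoc (A * V), sigmaMatrix_inv_mul_sigmaMatrix hne, Matrix.mul_one,
      Matrix.mul_assoc, ← star_eq_conjTranspose, Matrix.mem_unitaryGroup_iff.1 h.unitary,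
      Matrix.mul_one]

end SingularValues

section SVDPaths

variable {n : ℕ} {k l : ℕ∞} {A U V : ℝ → Matrix (Fin n) (Fin n) ℂ} {σ : ℝ → Fin n → ℝ} {t : ℝ}

theorem contDiffOn_conjTranspose_mul_self {E : Type*} [NormedAddCommGroup E] [NormedSpace ℝ E]
    {s : Set E} {A : E → Matrix (Fin n) (Fin n) ℂ} (hA : ContDiffOn ℝ k A s) :
    ContDiffOn ℝ k (fun x => (A x)ᴴ * A x) s :=
  ((starL' ℝ : Matrix (Fin n) (Fin n) ℂ ≃L[ℝ] _).contDiff.comp_contDiffOn hA).mul hA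

theorem contDiffOn_singularValue {E : Type*} [NormedAddCommGroup E] [NormedSpace ℝ E]
    {s : Set E} {A : E → Matrix (Fin n) (Fin n) ℂ} (hA : ContDiffOn ℝ k A s)
    (hdistinct : ∀ x ∈ s, StrictAnti (singularValue (A x)))
    (hpos : ∀ x ∈ s, ∀ j, 0 < singularValue (A x) j) :
    ContDiffOn ℝ k (fun x => singularValue (A x)) s := by
  choose W hW using fun x => exists_isEigendecomposition_conjTranspose_mul_self (A x)
  have hsq : ContDiffOn ℝ k (fun x => singularValue (A x) ^ 2) s :=
    contDiffOn_eigenvalues (contDiffOn_conjTranspose_mul_self hA)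
      (fun x hx => strictAnti_sq (hdistinct x hx) (hpos x hx)) fun x _ => hW x
  refine contDiffOn_pi.2 fun j => ?_
  refine ((contDiffOn_pi.1 hsq j).sqrt fun x hx => (pow_pos (hpos x hx j) 2).ne').congr ?_
  exact fun x hx => (Real.sqrt_sq (hpos x hx j).le).symm

theorem exists_isSVDPath (hA : ContDiffOn ℝ (k + 1) A (Icc 0 1))
    (hdistinct : ∀ t ∈ Icc (0 : ℝ) 1, StrictAnti (singularValue (A t)))
    (hpos : ∀ t ∈ Icc (0 : ℝ) 1, ∀ j, 0 < singularValue (A t) j)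
    {U₀ V₀ : Matrix (Fin n) (Fin n) ℂ} {σ₀ : Fin n → ℝ} (h₀ : IsSVD (A 0) U₀ σ₀ V₀) :
    ∃ U V : ℝ → Matrix (Fin n) (Fin n) ℂ,
      IsSVDPath (k + 1) A U (fun t => singularValue (A t)) V ∧ U 0 = U₀ ∧ V 0 = V₀ := by
  obtain rfl := h₀.eq_singularValue
  have hσ : ContDiffOn ℝ (k + 1) (fun t => singularValue (A t)) (Icc 0 1) :=
    contDiffOn_singularValue (k := k + 1) hA hdistinct hpos
  have hinj t (ht : t ∈ Icc (0 : ℝ) 1) : Function.Injective (singularValue (A t) ^ 2) :=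
    (strictAnti_sq (hdistinct t ht) (hpos t ht)).injective
  obtain ⟨V, hVd, hV0, hV⟩ := exists_contDiffOn_isEigendecomposition zero_lt_one
    (contDiffOn_conjTranspose_mul_self (k := k + 1) hA) (d := fun t => singularValue (A t) ^ 2)
    (hσ.pow 2) hinj (fun t _ => exists_isEigendecomposition_conjTranspose_mul_self (A t))
    h₀.isEigendecomposition
  have hinv : ContDiffOn ℝ (k + 1) (fun t => sigmaMatrix (singularValue (A t))⁻¹) (Icc 0 1) :=
    contDiff_sigmaMatrix.comp_contDiffOn <| contDiffOn_pi.2 fun j =>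
      (contDiffOn_pi.1 hσ j).inv fun t ht => (hpos t ht j).ne'
  refine ⟨fun t => A t * V t * sigmaMatrix (singularValue (A t))⁻¹, V,
    ⟨(hA.mul hVd).mul hinv, hσ, hVd,
      fun t ht => (hV t ht).isSVD (hpos t ht) (singularValue_antitone _)⟩, ?_, hV0⟩
  simp only [hV0]
  exact (h₀.left_eq fun j => (hpos 0 (left_mem_Icc.2 zero_le_one) j).ne').symm

theorem IsSVDPath.of_le (h : IsSVDPath k A U σ V) (hl : l ≤ k) : IsSVDPath l A U σ V where
  contDiffOn_left := h.contDiffOn_left.of_le (by exact_mod_cast hl)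
  contDiffOn_sigma := h.contDiffOn_sigma.of_le (by exact_mod_cast hl)
  contDiffOn_right := h.contDiffOn_right.of_le (by exact_mod_cast hl)
  isSVD := h.isSVD

theorem IsSVDPath.sigma_eq (h : IsSVDPath k A U σ V) (ht : t ∈ Icc (0 : ℝ) 1) :
    σ t = singularValue (A t) :=
  (h.isSVD t ht).eq_singularValue

end SVDPaths

section BodyVelocity

variable {n : ℕ} {k : ℕ∞} {U : ℝ → Matrix (Fin n) (Fin n) ℂ} {H : Matrix (Fin n) (Fin n) ℂ} {t : ℝ}

/-- The velocity `U* U'` of a path of unitary matrices on `[0,1]`, translated back to the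
identity. -/
def bodyVelocity (U : ℝ → Matrix (Fin n) (Fin n) ℂ) (t : ℝ) : Matrix (Fin n) (Fin n) ℂ :=
  (U t)ᴴ * derivWithin U (Icc 0 1) t

theorem contDiffOn_bodyVelocity (hU : ContDiffOn ℝ (k + 1) U (Icc 0 1)) :
    ContDiffOn ℝ k (bodyVelocity U) (Icc 0 1) :=
  ((starL' ℝ : Matrix (Fin n) (Fin n) ℂ ≃L[ℝ] _).contDiff.comp_contDiffOn
    (hU.of_le le_self_add)).mul (hU.derivWithin (uniqueDiffOn_Icc zero_lt_one) le_rfl)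

theorem hasDerivWithinAt_mul_bodyVelocity (hU : DifferentiableWithinAt ℝ U (Icc 0 1) t)
    (hu : U t ∈ Matrix.unitaryGroup (Fin n) ℂ) :
    HasDerivWithinAt U (U t * bodyVelocity U t) (Icc 0 1) t := by
  have hUU : U t * (U t)ᴴ = 1 := Matrix.mem_unitaryGroup_iff.1 hu
  have hvel : U t * bodyVelocity U t = derivWithin U (Icc 0 1) t := by
    rw [bodyVelocity, ← Matrix.mul_assoc, hUU, Matrix.one_mul]
  exact hU.hasDerivWithinAt.congr_deriv hvel.symm

theorem bodyVelocity_eq (ht : t ∈ Icc (0 : ℝ) 1) (hu : U t ∈ Matrix.unitaryGroup (Fin n) ℂ)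
    (hU : HasDerivWithinAt U (U t * H) (Icc 0 1) t) : bodyVelocity U t = H := by
  have hUU : (U t)ᴴ * U t = 1 := Matrix.mem_unitaryGroup_iff'.1 hu
  have hderiv : derivWithin U (Icc 0 1) t = U t * H :=
    hU.derivWithin (uniqueDiffOn_Icc zero_lt_one t ht)
  rw [bodyVelocity, hderiv, ← Matrix.mul_assoc, hUU, Matrix.one_mul]

theorem conjTranspose_bodyVelocity (hU : DifferentiableOn ℝ U (Icc 0 1))
    (hu : ∀ t ∈ Icc (0 : ℝ) 1, U t ∈ Matrix.unitaryGroup (Fin n) ℂ) (ht : t ∈ Icc (0 : ℝ) 1) :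
    (bodyVelocity U t)ᴴ = -bodyVelocity U t := by
  have hderiv := (hU t ht).hasDerivWithinAt
  have hconst : HasDerivWithinAt (fun t => (U t)ᴴ * U t) 0 (Icc 0 1) t :=
    (hasDerivWithinAt_const t (Icc 0 1) (1 : Matrix (Fin n) (Fin n) ℂ)).congr
      (fun s hs => Matrix.mem_unitaryGroup_iff'.1 (hu s hs))
      (Matrix.mem_unitaryGroup_iff'.1 (hu t ht))
  have hsum := (uniqueDiffOn_Icc zero_lt_one t ht).eq_deriv _ (hderiv.star.mul hderiv) hconst
  rw [bodyVelocity, Matrix.conjTranspose_mul, Matrix.conjTranspose_conjTranspose]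
  exact eq_neg_of_add_eq_zero_left hsum

end BodyVelocity

section FrobeniusNorm

variable {ι : Type*} [Fintype ι] {U M : Matrix ι ι ℂ}

theorem ofReal_frobenius_norm_sq (M : Matrix ι ι ℂ) : ((‖M‖ ^ 2 : ℝ) : ℂ) = (Mᴴ * M).trace := by
  have hsq : ‖M‖ ^ 2 = ∑ i, ∑ j, ‖M i j‖ ^ 2 := by
    rw [Matrix.frobenius_norm_def, ← Real.rpow_natCast, ← Real.rpow_mul (by positivity)]
    norm_num
  rw [hsq, Finset.sum_comm]
  simp [Matrix.trace, Matrix.mul_apply, ← Complex.conj_mul']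

variable [DecidableEq ι]

theorem frobenius_norm_unitary_mul (hU : U ∈ Matrix.unitaryGroup ι ℂ) (M : Matrix ι ι ℂ) :
    ‖U * M‖ = ‖M‖ := by
  have hUU : Uᴴ * U = 1 := Matrix.mem_unitaryGroup_iff'.1 hU
  refine (pow_left_inj₀ (norm_nonneg _) (norm_nonneg _) two_ne_zero).1 ?_
  rw [← Complex.ofReal_inj, ofReal_frobenius_norm_sq, ofReal_frobenius_norm_sq,
    Matrix.conjTranspose_mul, Matrix.mul_assoc, ← Matrix.mul_assoc Uᴴ, hUU, Matrix.one_mul]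

theorem frobenius_norm_mul_unitary (hU : U ∈ Matrix.unitaryGroup ι ℂ) (M : Matrix ι ι ℂ) :
    ‖M * U‖ = ‖M‖ := by
  rw [← Matrix.frobenius_norm_conjTranspose, Matrix.conjTranspose_mul,
    frobenius_norm_unitary_mul (U := Uᴴ) (Unitary.star_mem hU), Matrix.frobenius_norm_conjTranspose]

theorem trace_mul_diagonal_eq_zero {R : Type*} [NonUnitalNonAssocSemiring R] {M : Matrix ι ι R}
    (hM : ∀ j, M j j = 0) (r : ι → R) : (M * diagonal r).trace = 0 := by
  simp [Matrix.trace, hM]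

/-- Pythagoras: the pairs `(H, K)` with `Hⱼⱼ + Kⱼⱼ = 0` are orthogonal to the pairs `(D, D)` with
`D` diagonal. -/
theorem frobenius_norm_add_diagonal_sq_add {H K : Matrix ι ι ℂ} (hHK : ∀ j, H j j + K j j = 0)
    (r : ι → ℂ) :
    ‖H + diagonal r‖ ^ 2 + ‖K + diagonal r‖ ^ 2 = ‖H‖ ^ 2 + ‖K‖ ^ 2 + 2 * ‖diagonal r‖ ^ 2 := by
  have hcross : ((H + K)ᴴ * diagonal r).trace = 0 :=
    trace_mul_diagonal_eq_zero (fun j => by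
      rw [Matrix.conjTranspose_apply, Matrix.add_apply, hHK, star_zero]) r
  have hcross' : ((diagonal r)ᴴ * (H + K)).trace = 0 := by
    rw [Matrix.trace_mul_comm, Matrix.diagonal_conjTranspose]
    exact trace_mul_diagonal_eq_zero hHK _
  simp only [Matrix.conjTranspose_add, Matrix.add_mul, Matrix.mul_add,
    Matrix.trace_add] at hcross hcross'
  rw [← Complex.ofReal_inj]
  simp only [Complex.ofReal_add, Complex.ofReal_mul, Complex.ofReal_ofNat,
    ofReal_frobenius_norm_sq, Matrix.conjTranspose_add, Matrix.add_mul, Matrix.mul_add,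
    Matrix.trace_add]
  linear_combination hcross + hcross'

end FrobeniusNorm

section SVDEquations

variable {n : ℕ} {H K F : Matrix (Fin n) (Fin n) ℂ} {σ σ' : Fin n → ℝ} {j l : Fin n}

theorem star_apply_of_conjTranspose_eq_neg {ι : Type*} {M : Matrix ι ι ℂ} (hM : Mᴴ = -M)
    (j l : ι) : star (M l j) = -M j l :=
  congrFun (congrFun hM j) l

theorem re_apply_self_of_conjTranspose_eq_neg {ι : Type*} {M : Matrix ι ι ℂ} (hM : Mᴴ = -M)
    (j : ι) : (M j j).re = 0 :=
  self_eq_neg.1 <| by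
    simpa using congrArg Complex.re (star_apply_of_conjTranspose_eq_neg hM j j)

theorem drive_apply_of_ne (hF : F = H * sigmaMatrix σ + sigmaMatrix σ' - sigmaMatrix σ * K)
    (hjl : j ≠ l) : F j l = H j l * σ l - σ j * K j l := by
  simp [hF, sigmaMatrix, hjl]

theorem star_drive_apply_of_ne (hH : Hᴴ = -H) (hK : Kᴴ = -K)
    (hF : F = H * sigmaMatrix σ + sigmaMatrix σ' - sigmaMatrix σ * K) (hjl : j ≠ l) :
    star (F l j) = σ l * K j l - H j l * σ j := by
  rw [drive_apply_of_ne hF hjl.symm, star_sub, star_mul', star_mul',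
    star_apply_of_conjTranspose_eq_neg hH, star_apply_of_conjTranspose_eq_neg hK]
  simp only [RCLike.star_def, Complex.conj_ofReal]
  ring

theorem left_apply_mul_of_ne (hH : Hᴴ = -H) (hK : Kᴴ = -K)
    (hF : F = H * sigmaMatrix σ + sigmaMatrix σ' - sigmaMatrix σ * K) (hjl : j ≠ l) :
    H j l * ((σ l : ℂ) ^ 2 - (σ j : ℂ) ^ 2) = σ l * F j l + σ j * star (F l j) := by
  rw [drive_apply_of_ne hF hjl, star_drive_apply_of_ne hH hK hF hjl]
  ring

theorem right_apply_mul_of_ne (hH : Hᴴ = -H) (hK : Kᴴ = -K)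
    (hF : F = H * sigmaMatrix σ + sigmaMatrix σ' - sigmaMatrix σ * K) (hjl : j ≠ l) :
    K j l * ((σ l : ℂ) ^ 2 - (σ j : ℂ) ^ 2) = σ l * star (F l j) + σ j * F j l := by
  rw [drive_apply_of_ne hF hjl, star_drive_apply_of_ne hH hK hF hjl]
  ring

theorem left_sub_right_apply_self_mul (hH : Hᴴ = -H) (hK : Kᴴ = -K)
    (hF : F = H * sigmaMatrix σ + sigmaMatrix σ' - sigmaMatrix σ * K) :
    (H j j - K j j) * σ j = Complex.I * (F j j).im := by
  have hFjj : F j j = H j j * σ j + σ' j - σ j * K j j := by simp [hF, sigmaMatrix]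
  have hre := re_apply_self_of_conjTranspose_eq_neg hH j
  have hre' := re_apply_self_of_conjTranspose_eq_neg hK j
  apply Complex.ext
  · simp [hre, hre']
  · simp [hFjj, mul_sub, mul_comm]

end SVDEquations

namespace IsSVDPath

variable {n : ℕ} {A U V : ℝ → Matrix (Fin n) (Fin n) ℂ} {σ : ℝ → Fin n → ℝ} {t : ℝ}

theorem hasDerivWithinAt_left (h : IsSVDPath 1 A U σ V) (ht : t ∈ Icc (0 : ℝ) 1) :
    HasDerivWithinAt U (U t * bodyVelocity U t) (Icc 0 1) t :=
  hasDerivWithinAt_mul_bodyVelocity (h.contDiffOn_left.differentiableOn one_ne_zero t ht)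
    (h.isSVD t ht).unitary_left

theorem hasDerivWithinAt_right (h : IsSVDPath 1 A U σ V) (ht : t ∈ Icc (0 : ℝ) 1) :
    HasDerivWithinAt V (V t * bodyVelocity V t) (Icc 0 1) t :=
  hasDerivWithinAt_mul_bodyVelocity (h.contDiffOn_right.differentiableOn one_ne_zero t ht)
    (h.isSVD t ht).unitary_right

theorem conjTranspose_left (h : IsSVDPath 1 A U σ V) (ht : t ∈ Icc (0 : ℝ) 1) :
    (bodyVelocity U t)ᴴ = -bodyVelocity U t :=
  conjTranspose_bodyVelocity (h.contDiffOn_left.differentiableOn one_ne_zero)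
    (fun s hs => (h.isSVD s hs).unitary_left) ht

theorem conjTranspose_right (h : IsSVDPath 1 A U σ V) (ht : t ∈ Icc (0 : ℝ) 1) :
    (bodyVelocity V t)ᴴ = -bodyVelocity V t :=
  conjTranspose_bodyVelocity (h.contDiffOn_right.differentiableOn one_ne_zero)
    (fun s hs => (h.isSVD s hs).unitary_right) ht

theorem hasDerivWithinAt_sigmaMatrix (h : IsSVDPath 1 A U σ V) (ht : t ∈ Icc (0 : ℝ) 1) :
    HasDerivWithinAt (fun s => sigmaMatrix (σ s)) (sigmaMatrix (derivWithin σ (Icc 0 1) t))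
      (Icc 0 1) t := by
  have hσ := (h.contDiffOn_sigma.differentiableOn one_ne_zero t ht).hasDerivWithinAt
  refine hasDerivWithinAt_pi.2 fun i => hasDerivWithinAt_pi.2 fun j => ?_
  by_cases hij : i = j
  · subst hij
    simpa [sigmaMatrix] using (hasDerivWithinAt_pi.1 hσ i).ofReal_comp
  · simpa [sigmaMatrix, hij] using hasDerivWithinAt_const t (Icc (0 : ℝ) 1) (0 : ℂ)

theorem svdDrive_eq (h : IsSVDPath 1 A U σ V) (ht : t ∈ Icc (0 : ℝ) 1) :
    svdDrive A U V t = bodyVelocity U t * sigmaMatrix (σ t) +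
      sigmaMatrix (derivWithin σ (Icc 0 1) t) - sigmaMatrix (σ t) * bodyVelocity V t := by
  have hs := h.isSVD t ht
  have hA : derivWithin A (Icc 0 1) t =
      (U t * bodyVelocity U t * sigmaMatrix (σ t) +
        U t * sigmaMatrix (derivWithin σ (Icc 0 1) t)) * (V t)ᴴ +
          U t * sigmaMatrix (σ t) * (V t * bodyVelocity V t)ᴴ :=
    ((((h.hasDerivWithinAt_left ht).mul (h.hasDerivWithinAt_sigmaMatrix ht)).mul
      (h.hasDerivWithinAt_right ht).star).congr (fun s hs => (h.isSVD s hs).eq) hs.eq).derivWithin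
        (uniqueDiffOn_Icc zero_lt_one t ht)
  have hcancel (M : Matrix (Fin n) (Fin n) ℂ) : (U t)ᴴ * (U t * M) = M := by
    rw [← Matrix.mul_assoc, hs.conjTranspose_left_mul, Matrix.one_mul]
  rw [svdDrive, hA]
  simp only [Matrix.conjTranspose_mul, h.conjTranspose_right ht,
    Matrix.mul_add, Matrix.add_mul, Matrix.mul_assoc, hs.conjTranspose_right_mul, hcancel,
    Matrix.mul_one, Matrix.neg_mul, Matrix.mul_neg]
  abel

theorem svdEquations (h : IsSVDPath 1 A U σ V)
    (hdistinct : ∀ t ∈ Icc (0 : ℝ) 1, StrictAnti (singularValue (A t)))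
    (hpos : ∀ t ∈ Icc (0 : ℝ) 1, ∀ j, 0 < singularValue (A t) j) :
    SVDEquations A U σ V (bodyVelocity U) (bodyVelocity V) := by
  have hden t (ht : t ∈ Icc (0 : ℝ) 1) j l (hjl : j ≠ l) :
      (σ t l : ℂ) ^ 2 - (σ t j : ℂ) ^ 2 ≠ 0 := by
    rw [h.sigma_eq ht, sub_ne_zero]
    norm_cast
    rw [pow_left_inj₀ (hpos t ht l).le (hpos t ht j).le two_ne_zero]
    exact (hdistinct t ht).injective.ne hjl.symm
  refine ⟨fun t ht => ?_, fun t ht => h.hasDerivWithinAt_left ht,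
    fun t ht => h.hasDerivWithinAt_right ht, fun t ht => h.conjTranspose_left ht,
    fun t ht => h.conjTranspose_right ht, fun t ht j l hjl => ?_, fun t ht j l hjl => ?_,
    fun t ht j => ?_⟩
  · refine (h.hasDerivWithinAt_sigmaMatrix ht).congr_deriv ?_
    rw [h.svdDrive_eq ht]
    abel
  · exact eq_div_of_mul_eq (hden t ht j l hjl) <| left_apply_mul_of_ne
      (h.conjTranspose_left ht) (h.conjTranspose_right ht) (h.svdDrive_eq ht) hjl
  · exact eq_div_of_mul_eq (hden t ht j l hjl) <| right_apply_mul_of_ne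
      (h.conjTranspose_left ht) (h.conjTranspose_right ht) (h.svdDrive_eq ht) hjl
  · have hne : (σ t j : ℂ) ≠ 0 := by
      rw [h.sigma_eq ht]
      exact_mod_cast (hpos t ht j).ne'
    exact eq_div_of_mul_eq hne <| left_sub_right_apply_self_mul
      (h.conjTranspose_left ht) (h.conjTranspose_right ht) (h.svdDrive_eq ht)

end IsSVDPath

section Phases

variable {n : ℕ} {k : ℕ∞} {A U V P Q : ℝ → Matrix (Fin n) (Fin n) ℂ} {σ τ : ℝ → Fin n → ℝ}
  {e : ℝ → Fin n → ℂ} {t : ℝ}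

/-- A `C^k` path `e` of phase vectors `(e₁, …, eₙ)`, `|eⱼ(t)| = 1`, on `[0,1]`: the gauge freedom
of a singular value decomposition with distinct nonzero singular values. -/
structure IsPhase (k : ℕ∞) (e : ℝ → Fin n → ℂ) : Prop where
  contDiffOn : ContDiffOn ℝ k e (Icc 0 1)
  star_mul_self : ∀ t ∈ Icc (0 : ℝ) 1, star (e t) * e t = 1

/-- The change of gauge `U ↦ U diag(e)` of one unitary factor. -/
def rephase (U : ℝ → Matrix (Fin n) (Fin n) ℂ) (e : ℝ → Fin n → ℂ) (t : ℝ) :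
    Matrix (Fin n) (Fin n) ℂ :=
  U t * diagonal (e t)

/-- The logarithmic velocity `ē e'` of a path of phase vectors on `[0,1]`. -/
def phaseVelocity (e : ℝ → Fin n → ℂ) (t : ℝ) : Fin n → ℂ :=
  star (e t) * derivWithin e (Icc 0 1) t

theorem diagonal_mem_unitaryGroup {ι : Type*} [Fintype ι] [DecidableEq ι] {c : ι → ℂ}
    (hc : star c * c = 1) : diagonal c ∈ Matrix.unitaryGroup ι ℂ := by
  rw [Matrix.mem_unitaryGroup_iff', star_eq_conjTranspose, Matrix.diagonal_conjTranspose,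
    Matrix.diagonal_mul_diagonal, ← Matrix.diagonal_one]
  exact congrArg diagonal hc

theorem eq_diagonal_diag_of_commute {ι R : Type*} [Fintype ι] [DecidableEq ι] [CommRing R]
    [NoZeroDivisors R] {M : Matrix ι ι R} {d : ι → R} (hd : Function.Injective d)
    (hM : M * diagonal d = diagonal d * M) : M = diagonal M.diag := by
  ext i j
  rcases eq_or_ne i j with rfl | hij
  · simp
  · have hentry : M i j * d j = d i * M i j := by
      simpa using congrFun (congrFun hM i) j
    have hzero : (d i - d j) * M i j = 0 := by linear_combination -hentry
    rw [Matrix.diagonal_apply_ne _ hij]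
    exact (mul_eq_zero.1 hzero).resolve_left (sub_ne_zero.2 (hd.ne hij))

theorem IsSVD.mul_diagonal {A U V : Matrix (Fin n) (Fin n) ℂ} {σ : Fin n → ℝ} {c : Fin n → ℂ}
    (h : IsSVD A U σ V) (hc : star c * c = 1) :
    IsSVD A (U * diagonal c) σ (V * diagonal c) where
  unitary_left := mul_mem h.unitary_left (diagonal_mem_unitaryGroup hc)
  unitary_right := mul_mem h.unitary_right (diagonal_mem_unitaryGroup hc)
  nonneg := h.nonneg
  antitone := h.antitone
  eq := by
    have hcomm : diagonal c * sigmaMatrix σ = sigmaMatrix σ * diagonal c := by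
      simp [sigmaMatrix, mul_comm]
    have hcc : diagonal c * (diagonal c)ᴴ = 1 :=
      Matrix.mem_unitaryGroup_iff.1 (diagonal_mem_unitaryGroup hc)
    rw [Matrix.mul_assoc U, hcomm, Matrix.conjTranspose_mul, Matrix.mul_assoc, Matrix.mul_assoc,
      ← Matrix.mul_assoc (diagonal c), hcc, Matrix.one_mul, ← Matrix.mul_assoc, ← h.eq]

theorem IsSVD.conjTranspose_right_mul_eq_diagonal {A U V P Q : Matrix (Fin n) (Fin n) ℂ}
    {σ : Fin n → ℝ} (h : IsSVD A U σ V) (h' : IsSVD A P σ Q)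
    (hσ : Function.Injective (σ ^ 2)) : Vᴴ * Q = diagonal (Vᴴ * Q).diag := by
  refine eq_diagonal_diag_of_commute (Complex.ofReal_injective.comp hσ) ?_
  set D : Matrix (Fin n) (Fin n) ℂ := diagonal (Complex.ofReal ∘ (σ ^ 2))
  have hV : Aᴴ * A = V * D * Vᴴ := h.isEigendecomposition.eq
  have hQ : Aᴴ * A = Q * D * Qᴴ := h'.isEigendecomposition.eq
  calc Vᴴ * Q * D
      = Vᴴ * (Q * D * Qᴴ) * Q := by
        simp only [Matrix.mul_assoc, h'.conjTranspose_right_mul, Matrix.mul_one]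
    _ = Vᴴ * (V * D * Vᴴ) * Q := by rw [← hQ, hV]
    _ = D * (Vᴴ * Q) := by
        rw [Matrix.mul_assoc V, ← Matrix.mul_assoc, h.conjTranspose_right_mul, Matrix.one_mul,
          Matrix.mul_assoc]

theorem IsSVD.eq_mul_diagonal {A U V P Q : Matrix (Fin n) (Fin n) ℂ} {σ : Fin n → ℝ}
    (h : IsSVD A U σ V) (h' : IsSVD A P σ Q) (hσ : StrictAnti σ) (hpos : ∀ j, 0 < σ j) :
    star (Vᴴ * Q).diag * (Vᴴ * Q).diag = 1 ∧ P = U * diagonal (Vᴴ * Q).diag ∧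
      Q = V * diagonal (Vᴴ * Q).diag := by
  have hVV : V * Vᴴ = 1 := Matrix.mem_unitaryGroup_iff.1 h.unitary_right
  have hne j := (hpos j).ne'
  have hD : Vᴴ * Q = diagonal (Vᴴ * Q).diag :=
    h.conjTranspose_right_mul_eq_diagonal h' (strictAnti_sq hσ hpos).injective
  set c := (Vᴴ * Q).diag
  have hQ : Q = V * diagonal c := by
    rw [← hD, ← Matrix.mul_assoc, hVV, Matrix.one_mul]
  refine ⟨?_, ?_, hQ⟩
  · have hunit : (diagonal c)ᴴ * diagonal c = 1 := by
      rw [← hD, Matrix.conjTranspose_mul, Matrix.conjTranspose_conjTranspose, Matrix.mul_assoc,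
        ← Matrix.mul_assoc V, hVV, Matrix.one_mul, h'.conjTranspose_right_mul]
    rw [Matrix.diagonal_conjTranspose, Matrix.diagonal_mul_diagonal,
      ← Matrix.diagonal_one] at hunit
    exact Matrix.diagonal_injective hunit
  · have hcomm : diagonal c * sigmaMatrix σ⁻¹ = sigmaMatrix σ⁻¹ * diagonal c := by
      simp [sigmaMatrix, mul_comm]
    rw [h'.left_eq hne, hQ, ← Matrix.mul_assoc, Matrix.mul_assoc _ (diagonal c), hcomm,
      ← Matrix.mul_assoc, ← h.left_eq hne]

theorem hasDerivWithinAt_diagonal {e' : Fin n → ℂ} {s : Set ℝ} (he : HasDerivWithinAt e e' s t) :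
    HasDerivWithinAt (fun t => diagonal (e t)) (diagonal e') s t :=
  (Matrix.diagonalLinearMap (Fin n) ℝ ℂ).toContinuousLinearMap.hasFDerivAt.comp_hasDerivWithinAt
    t he

namespace IsPhase

theorem diagonal_mem (he : IsPhase k e) (ht : t ∈ Icc (0 : ℝ) 1) :
    diagonal (e t) ∈ Matrix.unitaryGroup (Fin n) ℂ :=
  diagonal_mem_unitaryGroup (he.star_mul_self t ht)

theorem of_le {l : ℕ∞} (he : IsPhase k e) (hl : l ≤ k) : IsPhase l e :=
  ⟨he.contDiffOn.of_le (by exact_mod_cast hl), he.star_mul_self⟩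

theorem const {c : Fin n → ℂ} (hc : star c * c = 1) : IsPhase k fun _ => c :=
  ⟨contDiffOn_const, fun _ _ => hc⟩

theorem hasDerivWithinAt (he : IsPhase 1 e) (ht : t ∈ Icc (0 : ℝ) 1) :
    HasDerivWithinAt e (e t * phaseVelocity e t) (Icc 0 1) t := by
  have hvel : e t * phaseVelocity e t = derivWithin e (Icc 0 1) t := by
    rw [phaseVelocity, ← mul_assoc, mul_comm (e t), he.star_mul_self t ht, one_mul]
  exact (he.contDiffOn.differentiableOn one_ne_zero t ht).hasDerivWithinAt.congr_deriv hvel.symm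

theorem phaseVelocity_eq {r : Fin n → ℂ} (he : IsPhase k e) (ht : t ∈ Icc (0 : ℝ) 1)
    (h : HasDerivWithinAt e (e t * r) (Icc 0 1) t) : phaseVelocity e t = r := by
  rw [phaseVelocity, h.derivWithin (uniqueDiffOn_Icc zero_lt_one t ht), ← mul_assoc,
    he.star_mul_self t ht, one_mul]

theorem eq_of_phaseVelocity_eq_zero (he : IsPhase 1 e)
    (h : ∀ t ∈ Icc (0 : ℝ) 1, phaseVelocity e t = 0) (ht : t ∈ Icc (0 : ℝ) 1) : e t = e 0 := by
  have hderiv t (ht : t ∈ Icc (0 : ℝ) 1) : HasDerivWithinAt e 0 (Icc 0 1) t :=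
    (he.hasDerivWithinAt ht).congr_deriv (by rw [h t ht, mul_zero])
  exact constant_of_derivWithin_zero (he.contDiffOn.differentiableOn one_ne_zero)
    (fun s hs => (hderiv s (Ico_subset_Icc_self hs)).derivWithin
      (uniqueDiffOn_Icc zero_lt_one s (Ico_subset_Icc_self hs))) t ht

end IsPhase

theorem bodyVelocity_rephase (he : IsPhase 1 e) (ht : t ∈ Icc (0 : ℝ) 1)
    (hU : DifferentiableWithinAt ℝ U (Icc 0 1) t) (hu : U t ∈ Matrix.unitaryGroup (Fin n) ℂ) :
    bodyVelocity (rephase U e) t =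
      (diagonal (e t))ᴴ * (bodyVelocity U t + diagonal (phaseVelocity e t)) * diagonal (e t) := by
  have hee : diagonal (e t) * (diagonal (e t))ᴴ = 1 :=
    Matrix.mem_unitaryGroup_iff.1 (he.diagonal_mem ht)
  refine bodyVelocity_eq ht (mul_mem hu (he.diagonal_mem ht)) ?_
  refine ((hasDerivWithinAt_mul_bodyVelocity hU hu).mul
    (hasDerivWithinAt_diagonal (he.hasDerivWithinAt ht))).congr_deriv ?_
  have hcomm : diagonal (e t * phaseVelocity e t) =
      diagonal (phaseVelocity e t) * diagonal (e t) := by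
    rw [mul_comm, Matrix.diagonal_mul_diagonal]
    rfl
  have hcancel (M : Matrix (Fin n) (Fin n) ℂ) : diagonal (e t) * ((diagonal (e t))ᴴ * M) = M := by
    rw [← Matrix.mul_assoc, hee, Matrix.one_mul]
  rw [hcomm]
  simp only [rephase, Matrix.mul_assoc, hcancel, Matrix.add_mul, Matrix.mul_add]

theorem bodyVelocity_rephase_apply_self (he : IsPhase 1 e) (ht : t ∈ Icc (0 : ℝ) 1)
    (hU : DifferentiableWithinAt ℝ U (Icc 0 1) t) (hu : U t ∈ Matrix.unitaryGroup (Fin n) ℂ)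
    (j : Fin n) :
    bodyVelocity (rephase U e) t j j = bodyVelocity U t j j + phaseVelocity e t j := by
  have hee : star (e t j) * e t j = 1 := congrFun (he.star_mul_self t ht) j
  rw [bodyVelocity_rephase he ht hU hu, Matrix.diagonal_conjTranspose, Matrix.mul_diagonal,
    Matrix.diagonal_mul, Matrix.add_apply, Matrix.diagonal_apply_eq, Pi.star_apply]
  linear_combination (bodyVelocity U t j j + phaseVelocity e t j) * hee

theorem norm_bodyVelocity (hu : U t ∈ Matrix.unitaryGroup (Fin n) ℂ) :
    ‖bodyVelocity U t‖ = ‖derivWithin U (Icc 0 1) t‖ :=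
  frobenius_norm_unitary_mul (U := (U t)ᴴ) (Unitary.star_mem hu) _

theorem norm_derivWithin_rephase (he : IsPhase 1 e) (ht : t ∈ Icc (0 : ℝ) 1)
    (hU : DifferentiableWithinAt ℝ U (Icc 0 1) t) (hu : U t ∈ Matrix.unitaryGroup (Fin n) ℂ) :
    ‖derivWithin (rephase U e) (Icc 0 1) t‖ =
      ‖bodyVelocity U t + diagonal (phaseVelocity e t)‖ := by
  have hD := he.diagonal_mem ht
  rw [← norm_bodyVelocity (U := rephase U e) (mul_mem hu hD), bodyVelocity_rephase he ht hU hu,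
    frobenius_norm_mul_unitary hD,
    frobenius_norm_unitary_mul (U := (diagonal (e t))ᴴ) (Unitary.star_mem hD)]

protected theorem IsSVDPath.rephase (h : IsSVDPath k A U σ V) (he : IsPhase k e) :
    IsSVDPath k A (rephase U e) σ (rephase V e) := by
  have hD : ContDiffOn ℝ k (fun t => diagonal (e t)) (Icc 0 1) :=
    (Matrix.diagonalLinearMap (Fin n) ℝ ℂ).toContinuousLinearMap.contDiff.comp_contDiffOn
      he.contDiffOn
  exact ⟨h.contDiffOn_left.mul hD, h.contDiffOn_sigma, h.contDiffOn_right.mul hD,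
    fun t ht => (h.isSVD t ht).mul_diagonal (he.star_mul_self t ht)⟩

theorem IsSVDPath.exists_isPhase (h : IsSVDPath k A U σ V) (h' : IsSVDPath k A P τ Q)
    (hdistinct : ∀ t ∈ Icc (0 : ℝ) 1, StrictAnti (singularValue (A t)))
    (hpos : ∀ t ∈ Icc (0 : ℝ) 1, ∀ j, 0 < singularValue (A t) j) :
    ∃ e, IsPhase k e ∧ EqOn P (rephase U e) (Icc 0 1) ∧
      EqOn Q (rephase V e) (Icc 0 1) := by
  have heq t (ht : t ∈ Icc (0 : ℝ) 1) := (h.sigma_eq ht ▸ h.isSVD t ht).eq_mul_diagonal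
    (h'.sigma_eq ht ▸ h'.isSVD t ht) (hdistinct t ht) (hpos t ht)
  have hVQ : ContDiffOn ℝ k (fun t => (V t)ᴴ * Q t) (Icc 0 1) :=
    ((starL' ℝ : Matrix (Fin n) (Fin n) ℂ ≃L[ℝ] _).contDiff.comp_contDiffOn
      h.contDiffOn_right).mul h'.contDiffOn_right
  have he : ContDiffOn ℝ k (fun t => ((V t)ᴴ * Q t).diag) (Icc 0 1) :=
    (Matrix.diagLinearMap (Fin n) ℝ ℂ).toContinuousLinearMap.contDiff.comp_contDiffOn hVQ
  exact ⟨_, ⟨he, fun t ht => (heq t ht).1⟩, fun t ht => (heq t ht).2.1, fun t ht => (heq t ht).2.2⟩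

end Phases

section JointVariation

variable {n : ℕ} {k m : ℕ∞} {A U V P Q : ℝ → Matrix (Fin n) (Fin n) ℂ} {σ τ : ℝ → Fin n → ℝ}
  {e : ℝ → Fin n → ℂ} {t : ℝ}

/-- The integrand `√(‖U'‖² + ‖V'‖²)` of the joint variation. -/
def jointSpeed (U V : ℝ → Matrix (Fin n) (Fin n) ℂ) (t : ℝ) : ℝ :=
  √(‖derivWithin U (Icc 0 1) t‖ ^ 2 + ‖derivWithin V (Icc 0 1) t‖ ^ 2)

/-- The condition `Hⱼⱼ + Kⱼⱼ = 0` on the body velocities `H = U* U'` and `K = V* V'`: the velocity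
of the pair `(U, V)` is orthogonal to every simultaneous change of phases. -/
def IsBalanced (U V : ℝ → Matrix (Fin n) (Fin n) ℂ) : Prop :=
  ∀ t ∈ Icc (0 : ℝ) 1, ∀ j, bodyVelocity U t j j + bodyVelocity V t j j = 0

theorem jointVariation_congr (hU : EqOn P U (Icc 0 1)) (hV : EqOn Q V (Icc 0 1)) :
    jointVariation P Q = jointVariation U V := by
  refine intervalIntegral.integral_congr fun t ht => ?_
  rw [uIcc_of_le zero_le_one] at ht
  have hU' : derivWithin P (Icc 0 1) t = derivWithin U (Icc 0 1) t := derivWithin_congr hU (hU ht)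
  have hV' : derivWithin Q (Icc 0 1) t = derivWithin V (Icc 0 1) t := derivWithin_congr hV (hV ht)
  simp only [hU', hV']

theorem bodyVelocity_congr (h : EqOn P U (Icc 0 1)) (ht : t ∈ Icc (0 : ℝ) 1) :
    bodyVelocity P t = bodyVelocity U t := by
  have hderiv : derivWithin P (Icc 0 1) t = derivWithin U (Icc 0 1) t := derivWithin_congr h (h ht)
  rw [bodyVelocity, bodyVelocity, h ht, hderiv]

namespace IsSVDPath

theorem continuousOn_jointSpeed (h : IsSVDPath 1 A U σ V) :
    ContinuousOn (jointSpeed U V) (Icc 0 1) := by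
  have hu : UniqueDiffOn ℝ (Icc (0 : ℝ) 1) := uniqueDiffOn_Icc zero_lt_one
  exact (((h.contDiffOn_left.continuousOn_derivWithin hu le_rfl).norm.pow 2).add
    ((h.contDiffOn_right.continuousOn_derivWithin hu le_rfl).norm.pow 2)).sqrt

theorem bodyVelocity_rephase_add (h : IsSVDPath 1 A U σ V) (he : IsPhase 1 e)
    (ht : t ∈ Icc (0 : ℝ) 1) (j : Fin n) :
    bodyVelocity (rephase U e) t j j + bodyVelocity (rephase V e) t j j =
      bodyVelocity U t j j + bodyVelocity V t j j + 2 * phaseVelocity e t j := by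
  rw [bodyVelocity_rephase_apply_self he ht (h.hasDerivWithinAt_left ht).differentiableWithinAt
      (h.isSVD t ht).unitary_left,
    bodyVelocity_rephase_apply_self he ht (h.hasDerivWithinAt_right ht).differentiableWithinAt
      (h.isSVD t ht).unitary_right]
  ring

theorem jointSpeed_rephase (h : IsSVDPath 1 A U σ V) (hbal : IsBalanced U V) (he : IsPhase 1 e)
    (ht : t ∈ Icc (0 : ℝ) 1) :
    jointSpeed (rephase U e) (rephase V e) t =
      √(jointSpeed U V t ^ 2 + 2 * ‖diagonal (phaseVelocity e t)‖ ^ 2) := by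
  have hs := h.isSVD t ht
  rw [jointSpeed, jointSpeed, Real.sq_sqrt (by positivity),
    norm_derivWithin_rephase he ht (h.hasDerivWithinAt_left ht).differentiableWithinAt
      hs.unitary_left,
    norm_derivWithin_rephase he ht (h.hasDerivWithinAt_right ht).differentiableWithinAt
      hs.unitary_right,
    frobenius_norm_add_diagonal_sq_add (hbal t ht), norm_bodyVelocity hs.unitary_left,
    norm_bodyVelocity hs.unitary_right]

theorem jointSpeed_le_rephase (h : IsSVDPath 1 A U σ V) (hbal : IsBalanced U V)
    (he : IsPhase 1 e) (ht : t ∈ Icc (0 : ℝ) 1) :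
    jointSpeed U V t ≤ jointSpeed (rephase U e) (rephase V e) t := by
  rw [h.jointSpeed_rephase hbal he ht]
  exact Real.le_sqrt_of_sq_le (le_add_of_nonneg_right (by positivity))

theorem jointSpeed_lt_rephase (h : IsSVDPath 1 A U σ V) (hbal : IsBalanced U V)
    (he : IsPhase 1 e) (ht : t ∈ Icc (0 : ℝ) 1) (hne : phaseVelocity e t ≠ 0) :
    jointSpeed U V t < jointSpeed (rephase U e) (rephase V e) t := by
  have hpos : 0 < ‖diagonal (phaseVelocity e t)‖ := by
    rw [norm_pos_iff, ne_eq, Matrix.diagonal_eq_zero]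
    exact hne
  rw [h.jointSpeed_rephase hbal he ht]
  exact Real.lt_sqrt_of_sq_lt (lt_add_of_pos_right _ (by positivity))

theorem jointVariation_le_rephase (h : IsSVDPath 1 A U σ V) (hbal : IsBalanced U V)
    (he : IsPhase 1 e) :
    jointVariation U V ≤ jointVariation (rephase U e) (rephase V e) :=
  intervalIntegral.integral_mono_on zero_le_one
    (h.continuousOn_jointSpeed.intervalIntegrable_of_Icc zero_le_one)
    ((h.rephase he).continuousOn_jointSpeed.intervalIntegrable_of_Icc zero_le_one)
    fun _ ht => h.jointSpeed_le_rephase hbal he ht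

theorem phase_eq_of_jointVariation_rephase_le (h : IsSVDPath 1 A U σ V) (hbal : IsBalanced U V)
    (he : IsPhase 1 e)
    (hle : jointVariation (rephase U e) (rephase V e) ≤ jointVariation U V)
    (ht : t ∈ Icc (0 : ℝ) 1) : e t = e 0 := by
  refine he.eq_of_phaseVelocity_eq_zero (fun s hs => ?_) ht
  by_contra hne
  exact hle.not_gt <| intervalIntegral.integral_lt_integral_of_continuousOn_of_le_of_exists_lt
    zero_lt_one h.continuousOn_jointSpeed (h.rephase he).continuousOn_jointSpeed
    (fun _ hr => h.jointSpeed_le_rephase hbal he (Ioc_subset_Icc_self hr))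
    ⟨s, hs, h.jointSpeed_lt_rephase hbal he hs hne⟩

theorem exists_isBalanced_rephase (h : IsSVDPath (m + 1) A U σ V) :
    ∃ e, IsPhase (m + 1) e ∧ e 0 = 1 ∧
      IsBalanced (rephase U e) (rephase V e) := by
  have h1 : IsSVDPath 1 A U σ V := h.of_le le_add_self
  set r : ℝ → Fin n → ℂ :=
    fun t j => -(1 / 2) * (bodyVelocity U t j j + bodyVelocity V t j j) with hr
  have hrd : ContDiffOn ℝ m r (Icc 0 1) := contDiffOn_pi.2 fun j =>
    let entry := (Matrix.entryLinearMap ℝ ℂ j j).toContinuousLinearMap.contDiff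
    contDiffOn_const.mul <|
      (entry.comp_contDiffOn (contDiffOn_bodyVelocity h.contDiffOn_left)).add
        (entry.comp_contDiffOn (contDiffOn_bodyVelocity h.contDiffOn_right))
  have hskew : ∀ t ∈ Icc (0 : ℝ) 1, star (r t) = -r t := fun t ht => by
    ext j
    have hH := star_apply_of_conjTranspose_eq_neg (h1.conjTranspose_left ht) j j
    have hK := star_apply_of_conjTranspose_eq_neg (h1.conjTranspose_right ht) j j
    simp only [hr, Pi.star_apply, Pi.neg_apply, star_mul', star_add, hH, hK]
    norm_num
    ring
  obtain ⟨e, hed, he0, hcurve⟩ := exists_contDiffOn_isIntegralCurveOn_mul zero_lt_one hrd 1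
  have he : IsPhase (m + 1) e := ⟨hed, star_mul_self_eq_one_of_isIntegralCurveOn_mul zero_lt_one
    hskew hcurve (by rw [he0, star_one, one_mul])⟩
  refine ⟨e, he, he0, fun t ht j => ?_⟩
  have hvel : phaseVelocity e t = r t :=
    he.phaseVelocity_eq ht ((hcurve t ht).congr_deriv (mul_comm (r t) (e t)))
  rw [h1.bodyVelocity_rephase_add (he.of_le le_add_self) ht, hvel, hr]
  ring

theorem exists_isBalanced (h : IsSVDPath (m + 1) A U σ V) :
    ∃ P Q, IsSVDPath (m + 1) A P σ Q ∧ IsBalanced P Q ∧ P 0 = U 0 ∧ Q 0 = V 0 := by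
  obtain ⟨e, he, he0, hbal⟩ := h.exists_isBalanced_rephase
  have hinit (W : ℝ → Matrix (Fin n) (Fin n) ℂ) : rephase W e 0 = W 0 := by
    rw [rephase, he0, Matrix.diagonal_one', Matrix.mul_one]
  exact ⟨_, _, h.rephase he, hbal, hinit U, hinit V⟩

theorem isJointMVD_of_isBalanced (h : IsSVDPath k A U σ V) (hk : 1 ≤ k)
    (hdistinct : ∀ t ∈ Icc (0 : ℝ) 1, StrictAnti (singularValue (A t)))
    (hpos : ∀ t ∈ Icc (0 : ℝ) 1, ∀ j, 0 < singularValue (A t) j) (hbal : IsBalanced U V) :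
    IsJointMVD k A U σ V := by
  refine ⟨h, fun P τ Q h' => ?_⟩
  obtain ⟨e, he, hP, hQ⟩ := (h.of_le hk).exists_isPhase h' hdistinct hpos
  rw [jointVariation_congr hP hQ]
  exact (h.of_le hk).jointVariation_le_rephase hbal he

end IsSVDPath

namespace IsJointMVD

theorem exists_eqOn_rephase_const (h : IsJointMVD k A P τ Q) (hk : 1 ≤ k)
    (hdistinct : ∀ t ∈ Icc (0 : ℝ) 1, StrictAnti (singularValue (A t)))
    (hpos : ∀ t ∈ Icc (0 : ℝ) 1, ∀ j, 0 < singularValue (A t) j)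
    (h' : IsSVDPath 1 A U σ V) (hbal : IsBalanced U V) :
    ∃ c : Fin n → ℂ, star c * c = 1 ∧ EqOn P (rephase U fun _ => c) (Icc 0 1) ∧
      EqOn Q (rephase V fun _ => c) (Icc 0 1) := by
  obtain ⟨e, he, hP, hQ⟩ := h'.exists_isPhase (h.1.of_le hk) hdistinct hpos
  have hle : jointVariation (rephase U e) (rephase V e) ≤ jointVariation U V := by
    rw [← jointVariation_congr hP hQ]
    exact h.2 U σ V h'
  have hconst t (ht : t ∈ Icc (0 : ℝ) 1) : e t = e 0 :=
    h'.phase_eq_of_jointVariation_rephase_le hbal he hle ht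
  refine ⟨e 0, he.star_mul_self 0 (left_mem_Icc.2 zero_le_one), fun t ht => ?_, fun t ht => ?_⟩
  · rw [hP ht, rephase, rephase, hconst t ht]
  · rw [hQ ht, rephase, rephase, hconst t ht]

theorem isBalanced (h : IsJointMVD (m + 1) A U σ V)
    (hdistinct : ∀ t ∈ Icc (0 : ℝ) 1, StrictAnti (singularValue (A t)))
    (hpos : ∀ t ∈ Icc (0 : ℝ) 1, ∀ j, 0 < singularValue (A t) j) : IsBalanced U V := by
  obtain ⟨P, Q, hPQ, hbal, -⟩ := h.1.exists_isBalanced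
  have hPQ1 : IsSVDPath 1 A P σ Q := hPQ.of_le le_add_self
  obtain ⟨c, hc, hU, hV⟩ :=
    h.exists_eqOn_rephase_const le_add_self hdistinct hpos hPQ1 hbal
  intro t ht j
  have hvel : phaseVelocity (fun _ => c) t = 0 := by simp [phaseVelocity]
  rw [bodyVelocity_congr hU ht, bodyVelocity_congr hV ht,
    hPQ1.bodyVelocity_rephase_add (IsPhase.const hc) ht, hbal t ht, hvel, Pi.zero_apply,
    mul_zero, add_zero]

theorem eqOn (h : IsJointMVD (m + 1) A U σ V) (h' : IsJointMVD (m + 1) A P τ Q)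
    (hdistinct : ∀ t ∈ Icc (0 : ℝ) 1, StrictAnti (singularValue (A t)))
    (hpos : ∀ t ∈ Icc (0 : ℝ) 1, ∀ j, 0 < singularValue (A t) j) (h0 : P 0 = U 0) :
    EqOn P U (Icc 0 1) ∧ EqOn τ σ (Icc 0 1) ∧ EqOn Q V (Icc 0 1) := by
  have mem0 : (0 : ℝ) ∈ Icc (0 : ℝ) 1 := left_mem_Icc.2 zero_le_one
  obtain ⟨c, -, hP, hQ⟩ := h'.exists_eqOn_rephase_const le_add_self hdistinct hpos
    (h.1.of_le le_add_self) (h.isBalanced hdistinct hpos)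
  have hc : diagonal c = 1 := by
    have hUU := (h.1.isSVD 0 mem0).conjTranspose_left_mul
    have hUc : U 0 = U 0 * diagonal c := h0.symm.trans (hP mem0)
    rw [← Matrix.one_mul (diagonal c), ← hUU, Matrix.mul_assoc, ← hUc]
  refine ⟨fun t ht => ?_, fun t ht => (h'.1.sigma_eq ht).trans (h.1.sigma_eq ht).symm,
    fun t ht => ?_⟩
  · rw [hP ht, rephase, hc, Matrix.mul_one]
  · rw [hQ ht, rephase, hc, Matrix.mul_one]

end IsJointMVD

theorem SVDEquations.isBalanced {H K : ℝ → Matrix (Fin n) (Fin n) ℂ}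
    (hHK : SVDEquations A U σ V H K) (h : IsSVDPath k A U σ V)
    (hdiag : ∀ t ∈ Icc (0 : ℝ) 1, ∀ j, H t j j + K t j j = 0) : IsBalanced U V := by
  intro t ht j
  rw [bodyVelocity_eq ht (h.isSVD t ht).unitary_left (hHK.deriv_left t ht),
    bodyVelocity_eq ht (h.isSVD t ht).unitary_right (hHK.deriv_right t ht)]
  exact hdiag t ht j

end JointVariation

end

theorem theorem3p5 (n : ℕ) (k : ℕ∞) (hk : 1 ≤ k)
    (A : ℝ → Matrix (Fin n) (Fin n) ℂ) (hA : ContDiffOn ℝ k A (Icc 0 1))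
    (hdistinct : ∀ t ∈ Icc (0 : ℝ) 1, StrictAnti (singularValue (A t)))
    (hpos : ∀ t ∈ Icc (0 : ℝ) 1, ∀ j, 0 < singularValue (A t) j) :
    (∀ (U₀ : Matrix (Fin n) (Fin n) ℂ) (σ₀ : Fin n → ℝ) (V₀ : Matrix (Fin n) (Fin n) ℂ),
      IsSVD (A 0) U₀ σ₀ V₀ →
      ∃ (U : ℝ → Matrix (Fin n) (Fin n) ℂ) (σ : ℝ → Fin n → ℝ)
        (V : ℝ → Matrix (Fin n) (Fin n) ℂ),
        (IsJointMVD k A U σ V ∧ U 0 = U₀ ∧ σ 0 = σ₀ ∧ V 0 = V₀) ∧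
        ∀ (P : ℝ → Matrix (Fin n) (Fin n) ℂ) (τ : ℝ → Fin n → ℝ)
          (Q : ℝ → Matrix (Fin n) (Fin n) ℂ),
          IsJointMVD k A P τ Q → P 0 = U₀ → τ 0 = σ₀ → Q 0 = V₀ →
            EqOn P U (Icc 0 1) ∧ EqOn τ σ (Icc 0 1) ∧ EqOn Q V (Icc 0 1)) ∧
    (∀ (U : ℝ → Matrix (Fin n) (Fin n) ℂ) (σ : ℝ → Fin n → ℝ)
      (V : ℝ → Matrix (Fin n) (Fin n) ℂ),
      IsSVDPath k A U σ V →
      (IsJointMVD k A U σ V ↔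
        ∃ H K : ℝ → Matrix (Fin n) (Fin n) ℂ,
          SVDEquations A U σ V H K ∧
            ∀ t ∈ Icc (0 : ℝ) 1, ∀ j, H t j j + K t j j = 0)) := by
  obtain ⟨m, rfl⟩ : ∃ m : ℕ∞, k = m + 1 := ⟨k - 1, (tsub_add_cancel_of_le hk).symm⟩
  refine ⟨fun U₀ σ₀ V₀ h₀ => ?_, fun U σ V h => ⟨fun hmin => ?_, ?_⟩⟩
  · obtain ⟨U', V', h', hU', hV'⟩ := exists_isSVDPath hA hdistinct hpos h₀
    obtain ⟨U, V, h, hbal, hU, hV⟩ := h'.exists_isBalanced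
    have hmin := h.isJointMVD_of_isBalanced hk hdistinct hpos hbal
    exact ⟨U, _, V, ⟨hmin, hU.trans hU', h₀.eq_singularValue.symm, hV.trans hV'⟩,
      fun P τ Q hPQ hP _ _ => hmin.eqOn hPQ hdistinct hpos (hP.trans (hU.trans hU').symm)⟩
  · exact ⟨bodyVelocity U, bodyVelocity V, (h.of_le hk).svdEquations hdistinct hpos,
      hmin.isBalanced hdistinct hpos⟩
  · rintro ⟨H, K, hHK, hdiag⟩
    exact h.isJointMVD_of_isBalanced hk hdistinct hpos (hHK.isBalanced h hdiag)
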